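/- A Markov decision process (MDP) $P=((V,E),\langle V_1,V_R\rangle,\delta)$ consists of a finite non-empty set $V$ of $n$ vertices partitioned into player-1 vertices $V_1$ and random vertices $V_R$, a set $E\subseteq V\times V$ of edges, without self-loops and such that every vertex has an outgoing edge, and a probability distribution $\delta(v)$ on $V$ for each $v\in V_R$, with $\delta(v)[w]>0$ if and only if $(v,w)\in E$. A strategy $\sigma$ of player 1 assigns to each finite history that ends in a vertex $v\in V_1$ a successor of $v$; $\Pr^\sigma_v$ is the law of the random play that starts in $v$ and follows $\sigma$ at player-1 vertices and $\delta$ at random vertices. For $T\subseteq V$ let $\mathrm{Reach}(T)$ be the set of infinite paths of $(V,E)$ that visit $T$, and let $\mathrm{ASW}(\mathrm{Reach}(T))$ be the set of vertices $v$ for which there is a strategy $\sigma$ with $\Pr_v^\sigma(\mathrm{Reach}(T))=1$. A set-based symbolic algorithm is a program of a random-access machine which can, besides computing with natural numbers, store sets of vertices and sets of edges, but has access to them only by the symbolic operations: $\cup,\cap,\setminus,\subseteq,=$ on two sets of vertices or two sets of edges; the product $\times$ of two sets of vertices; $\mathrm{Pre}_F(S)=\{v \mid \exists w\in S,\ (v,w)\in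 F\}$ and $\mathrm{Post}_F(S)=\{w\mid\exists v\in S,\ (v,w)\in F\}$ for a set $F$ of edges and a set $S$ of vertices; $\mathrm{Pick}(S)$, which returns an arbitrary vertex of $S$ (as a singleton set); and the cardinality $|S|$. Its time is the number of symbolic operations that it performs, and its symbolic space is the maximal number of sets that it stores simultaneously. Its input is $V$, $E$, $V_1$, $V_R$, $T$ (as stored sets) and one natural number $p$, the trade-off parameter. **Theorem.** There are a set-based symbolic algorithm $\mathcal A$ and constants $C,k$ such that for every MDP $P$ with $n$ vertices and every set $T$ of vertices, however the choices of $\mathrm{Pick}$ are made, the following holds. For every value of the parameter $p$, the algorithm halts and returns $\mathrm{ASW}(\mathrm{Reach}(T))$. For every real $\epsilon$ with $0<\epsilon\le 1/2$, when it is run with $p=\lceil n^\epsilon\rceil$ it performs at most $C\,n^{2-\epsilon}(\log n)^k$ symbolic operations and uses symbolic space at most $C\,n^{\epsilon}(\log n)^k$; that is, $\mathrm{ASW}(\mathrm{Reach}(T))$ is computed with $\widetilde O(n^{2-\epsilon})$ symbolic operations and $\widetilde O(n^{\epsilon})$ symbolic space. -/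

import Mathlib

open MeasureTheory ProbabilityTheory

/-! ### Markov decision processes and almost-sure reachability -/

/-- A Markov decision process on the vertex set `V`. The player-1 vertices are `V1`, the random
vertices are the remaining ones. There are no self-loops and every vertex has an outgoing edge. -/
structure MDP (V : Type*) where
  E : Set (V × V)
  V1 : Set V
  δ : (V1ᶜ : Set V) → PMF V
  mem_E_iff : ∀ (v : (V1ᶜ : Set V)) (w : V), ((v : V), w) ∈ E ↔ 0 < δ v w
  no_loop : ∀ v, (v, v) ∉ E
  exists_out : ∀ v, ∃ w, (v, w) ∈ E

namespace MDP

variable {V : Type*}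

/-- The random vertices. -/
def VR (P : MDP V) : Set V := P.V1ᶜ

/-- A (history-dependent) strategy of player 1: `move w v` is the successor chosen after the
history `w · v`, where `v` is a player-1 vertex. -/
structure Strategy (P : MDP V) where
  move : List V → P.V1 → V
  edge : ∀ (w : List V) (v : P.V1), ((v : V), move w v) ∈ P.E

open Classical in
/-- The distribution of the next vertex after the history `w · v`. -/
noncomputable def next (P : MDP V) (σ : P.Strategy) (w : List V) (v : V) : PMF V :=
  if h : v ∈ P.V1 then PMF.pure (σ.move w ⟨v, h⟩) else P.δ ⟨v, h⟩

/-- The distribution of the vertex number `n + 1` of a play, given the vertices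
number `0, …, n`. -/
noncomputable def stepKernel [Fintype V] [MeasurableSpace V] [DiscreteMeasurableSpace V]
    (P : MDP V) (σ : P.Strategy) (n : ℕ) : Kernel (Finset.Iic n → V) V :=
  Kernel.ofFunOfCountable fun h =>
    (P.next σ (List.ofFn fun i : Fin n => h ⟨i, Finset.mem_Iic.2 i.2.le⟩)
      (h ⟨n, Finset.mem_Iic.2 le_rfl⟩)).toMeasure

instance [Fintype V] [MeasurableSpace V] [DiscreteMeasurableSpace V]
    (P : MDP V) (σ : P.Strategy) (n : ℕ) : IsMarkovKernel (P.stepKernel σ n) :=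
  ⟨fun _ => PMF.toMeasure.isProbabilityMeasure _⟩

/-- The law of the random play that starts in `v` when player 1 follows `σ`. -/
noncomputable def law [Fintype V] [MeasurableSpace V] [DiscreteMeasurableSpace V]
    (P : MDP V) (σ : P.Strategy) (v : V) : Measure (ℕ → V) :=
  Kernel.traj (X := fun _ => V) (fun n => P.stepKernel σ n) 0 (fun _ => v)

/-- The plays: infinite paths. -/
def plays (P : MDP V) : Set (ℕ → V) := {ω | ∀ k, (ω k, ω (k + 1)) ∈ P.E}

/-- The reachability objective: some vertex of `T` is visited. -/
def Reach (P : MDP V) (T : Set V) : Set (ℕ → V) := {ω | ω ∈ P.plays ∧ ∃ k, ω k ∈ T}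

/-- The almost-sure winning set of the objective `Φ`. -/
def ASW [Fintype V] [MeasurableSpace V] [DiscreteMeasurableSpace V]
    (P : MDP V) (Φ : Set (ℕ → V)) : Set V :=
  {v | ∃ σ : P.Strategy, P.law σ v Φ = 1}

end MDP

/-! ### Set-based symbolic algorithms

A symbolic algorithm is a program of a random-access machine. Besides its number memory (cells
indexed by `ℕ`, holding natural numbers) the machine has cells for sets of vertices and cells for
sets of edges. Sets are only accessible through symbolic operations. Only the symbolic operations
are counted as time, and only stored sets are counted as space. -/

namespace Symbolic

/-- Arithmetic expressions over the number memory. `load` reads the cell whose address is the value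
of its argument; `sub` is truncated, `div` and `mod` are integral, `log` is the floor of the binary
logarithm. -/
inductive Expr where
  | const (n : ℕ)
  | load (a : Expr)
  | add (a b : Expr)
  | sub (a b : Expr)
  | mul (a b : Expr)
  | div (a b : Expr)
  | mod (a b : Expr)
  | pow (a b : Expr)
  | log (a : Expr)

/-- The value of an expression when the number memory is `m`. -/
def Expr.eval (m : ℕ → ℕ) : Expr → ℕ
  | .const n => n
  | .load a => m (a.eval m)
  | .add a b => a.eval m + b.eval m
  | .sub a b => a.eval m - b.eval m
  | .mul a b => a.eval m * b.eval m
  | .div a b => a.eval m / b.eval m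
  | .mod a b => a.eval m % b.eval m
  | .pow a b => a.eval m ^ b.eval m
  | .log a => Nat.log 2 (a.eval m)

/-- The basic set operations that return a set of the same kind as the operands. -/
inductive SetOp where
  | union
  | inter
  | diff

/-- The set that results from a basic set operation. -/
def SetOp.apply {α : Type*} : SetOp → Set α → Set α → Set α
  | .union, A, B => A ∪ B
  | .inter, A, B => A ∩ B
  | .diff, A, B => A \ B

/-- Symbolic operations. All arguments are expressions whose values are addresses: `dst` is the
address of the cell that receives the result, the others are those of the operands. -/
inductive Op where
  /-- a basic set operation on two sets of vertices -/
  | vertexOp (o : SetOp) (dst x y : Expr)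
  /-- a basic set operation on two sets of edges -/
  | edgeOp (o : SetOp) (dst x y : Expr)
  /-- inclusion test for sets of vertices; the result `0` or `1` is a number -/
  | vertexSubset (dst x y : Expr)
  /-- inclusion test for sets of edges -/
  | edgeSubset (dst x y : Expr)
  /-- equality test for sets of vertices -/
  | vertexEq (dst x y : Expr)
  /-- equality test for sets of edges -/
  | edgeEq (dst x y : Expr)
  /-- the product of two sets of vertices, a set of edges -/
  | prod (dst x y : Expr)
  /-- the predecessors of the set of vertices `x` with respect to the edge set `e` -/
  | pre (dst e x : Expr)
  /-- the successors of the set of vertices `x` with respect to the edge set `e` -/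
  | post (dst e x : Expr)
  /-- an arbitrary vertex of the set of vertices `x`, as a singleton -/
  | pick (dst x : Expr)
  /-- the cardinality of the set of vertices `x`, a number -/
  | card (dst x : Expr)

/-- Programs. -/
inductive Prog where
  | skip
  | seq (p q : Prog)
  /-- branch on whether the value of `b` is non-zero -/
  | ite (b : Expr) (p q : Prog)
  /-- repeat the body while the value of `b` is non-zero -/
  | loop (b : Expr) (p : Prog)
  /-- store the value of `e` in the number cell with address `a` -/
  | assign (a e : Expr)
  /-- discard the set of vertices in the cell with address `a` -/
  | freeVertex (a : Expr)
  /-- discard the set of edges in the cell with address `a` -/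
  | freeEdge (a : Expr)
  | op (o : Op)

/-- Configurations: the memory contents (`none` for a cell that stores no set), the number of
symbolic operations so far, and the maximal number of simultaneously stored sets so far. -/
structure State (V : Type*) where
  num : ℕ → ℕ
  vset : ℕ → Option (Set V)
  eset : ℕ → Option (Set (V × V))
  ops : ℕ
  peak : ℕ∞

/-- A resolution of the choices of the pick operation: the vertex picked from a set may depend on
the time, so that repeated picks from the same set may differ. -/
structure Picker (V : Type*) where
  choose : ℕ → Set V → V
  choose_mem : ∀ t S, S.Nonempty → choose t S ∈ S

namespace State

variable {V : Type*}

/-- The number of sets that are currently stored. -/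
noncomputable def stored (s : State V) : ℕ∞ :=
  {i | s.vset i ≠ none}.encard + {i | s.eset i ≠ none}.encard

/-- Update the maximal number of stored sets. -/
noncomputable def track (s : State V) : State V := { s with peak := max s.peak s.stored }

/-- The value of an expression. -/
def val (s : State V) (a : Expr) : ℕ := a.eval s.num

/-- The set of vertices in a cell; a cell that stores no set reads as the empty set. -/
def getV (s : State V) (a : Expr) : Set V := (s.vset (s.val a)).getD ∅

/-- The set of edges in a cell; a cell that stores no set reads as the empty set. -/
def getE (s : State V) (a : Expr) : Set (V × V) := (s.eset (s.val a)).getD ∅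

/-- Write a number. -/
def putN (s : State V) (a : Expr) (k : ℕ) : State V :=
  { s with num := Function.update s.num (s.val a) k }

/-- Write or discard a set of vertices. -/
def putV (s : State V) (a : Expr) (A : Option (Set V)) : State V :=
  { s with vset := Function.update s.vset (s.val a) A }

/-- Write or discard a set of edges. -/
def putE (s : State V) (a : Expr) (A : Option (Set (V × V))) : State V :=
  { s with eset := Function.update s.eset (s.val a) A }

open Classical in
/-- The effect of a symbolic operation on the memory. -/
noncomputable def effect (ρ : Picker V) (s : State V) : Op → State V
  | .vertexOp o d x y => s.putV d (some (o.apply (s.getV x) (s.getV y)))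
  | .edgeOp o d x y => s.putE d (some (o.apply (s.getE x) (s.getE y)))
  | .vertexSubset d x y => s.putN d (if s.getV x ⊆ s.getV y then 1 else 0)
  | .edgeSubset d x y => s.putN d (if s.getE x ⊆ s.getE y then 1 else 0)
  | .vertexEq d x y => s.putN d (if s.getV x = s.getV y then 1 else 0)
  | .edgeEq d x y => s.putN d (if s.getE x = s.getE y then 1 else 0)
  | .prod d x y => s.putE d (some (s.getV x ×ˢ s.getV y))
  | .pre d e x => s.putV d (some {v | ∃ w ∈ s.getV x, (v, w) ∈ s.getE e})
  | .post d e x => s.putV d (some {w | ∃ v ∈ s.getV x, (v, w) ∈ s.getE e})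
  | .pick d x => s.putV d (some {v | v ∈ s.getV x ∧ v = ρ.choose s.ops (s.getV x)})
  | .card d x => s.putN d (s.getV x).ncard

/-- Perform one symbolic operation, with the accounting of time and space. -/
noncomputable def perform (ρ : Picker V) (s : State V) (o : Op) : State V :=
  { (s.effect ρ o).track with ops := s.ops + 1 }

end State

/-- `Exec ρ p s s'`: the program `p`, started in the configuration `s`, halts in the
configuration `s'`, when the choices are resolved by `ρ`. -/
inductive Exec {V : Type*} (ρ : Picker V) : Prog → State V → State V → Prop where
  | skip (s) : Exec ρ .skip s s
  | seq {p q s t u} : Exec ρ p s t → Exec ρ q t u → Exec ρ (.seq p q) s u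
  | ite_true {b p q s t} : s.val b ≠ 0 → Exec ρ p s t → Exec ρ (.ite b p q) s t
  | ite_false {b p q s t} : s.val b = 0 → Exec ρ q s t → Exec ρ (.ite b p q) s t
  | loop_done {b p s} : s.val b = 0 → Exec ρ (.loop b p) s s
  | loop_step {b p s t u} : s.val b ≠ 0 → Exec ρ p s t → Exec ρ (.loop b p) t u →
      Exec ρ (.loop b p) s u
  | assign (a e s) : Exec ρ (.assign a e) s (s.putN a (s.val e))
  | freeVertex (a s) : Exec ρ (.freeVertex a) s (s.putV a none)
  | freeEdge (a s) : Exec ρ (.freeEdge a) s (s.putE a none)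
  | op (o s) : Exec ρ (.op o) s (s.perform ρ o)

/-- The initial configuration for the MDP `P`, the target set `T` and the number parameter `p`.
The vertex-set cells `0, 1, 2, 3` hold the set of all vertices, the player-1 vertices, the random
vertices and `T`; the edge-set cell `0` holds the edges; the number cell `0` holds `p`. -/
noncomputable def init {V : Type*} (P : MDP V) (T : Set V) (p : ℕ) : State V :=
  State.track
    { num := fun i => if i = 0 then p else 0
      vset := fun i => if i = 0 then some Set.univ else if i = 1 then some P.V1
        else if i = 2 then some P.VR else if i = 3 then some T else none
      eset := fun i => if i = 0 then some P.E else none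
      ops := 0
      peak := 0 }

/-- The program `A`, on the input `P`, `T` with number parameter `p`, halts in the configuration `s`
with the set of vertices `R` as its output, in the vertex-set cell `0`. -/
def Computes {V : Type*} (ρ : Picker V) (A : Prog) (P : MDP V) (T : Set V) (p : ℕ) (R : Set V)
    (s : State V) : Prop :=
  Exec ρ A (init P T p) s ∧ s.vset 0 = some R

end Symbolic

/-! The almost-sure winning set $W$ is the largest vertex set $A$ such that random vertices of
$A\setminus T$ have all successors in $A$ and every vertex of $A$ has a path to $T$ inside $A$. That
$W$ has these properties follows by conditioning on the first step (`law_eq_sum`):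
`asw_reach_random`, `asw_reach_leads`. Conversely, on such an $A$ the memoryless strategy that
decreases the distance to $T$ wins almost surely, by a maximum principle for the probability of
missing $T$ (`subset_asw_of_closed`).

The algorithm keeps a candidate set $A\supseteq W$ and deletes vertices until $A$ has both
properties. Vertices receive binary labels; one stored set per bit, hence about $\log n$ sets,
translates between singletons and numbers. So part of the graph can be held in number memory, where
computation is free. A vertex outside $T$ is read, that is, its successors in $A$ are recorded, once
it has at most $p$ of them; as $A$ only shrinks, the record stays complete. Let $U$ be the unread
vertices; it always contains $T$.

A round reads what can be read (`run_scan`) and prunes (`run_prune`): it deletes random vertices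
outside $T$ with an edge leaving $A$, and vertices that cannot reach $U$ inside $A$, which the
recorded graph reveals for free. Then one backward search deletes the vertices that cannot reach $T$
(`run_reach`). If the last step deletes something, some surviving $u\in U\setminus T$ could not
reach $T$. This $u$ had more than $p$ successors in the candidate set at the time of the scan, and
none of them survives the round. So every round but the last deletes at least $p+1$ vertices, and
there are at most $n/(p+1)+1$ rounds (`run_mainLoop`).

A round costs $O(n)$ operations apart from reading and deleting. Reading costs $O(p\log n)$ and
deleting $O(\log n)$ per vertex, each at most once per vertex. The total $\widetilde O(n^2/p+np)$ is
$\widetilde O(n^{2-\epsilon})$ for $p=\lceil n^\epsilon\rceil$ and $\epsilon\le1/2$ (`cost_bound`).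
Since numbers are not counted as space, $O(\log n)$ stored sets suffice. -/

namespace MDP

variable {V : Type*}

/-! ### The law of a play and its decomposition at the first step. -/

/-- The sequences that agree with `a` up to time `k`. -/
def cylinder (a : ℕ → V) (k : ℕ) : Set (ℕ → V) := {ω | ∀ i ≤ k, ω i = a i}

theorem cylinder_subset (a : ℕ → V) {j k : ℕ} (h : j ≤ k) : cylinder a k ⊆ cylinder a j :=
  fun _ hω i hi => hω i (hi.trans h)

/-- The strategy that continues `σ` after the first vertex `v`. -/
def Strategy.shift {P : MDP V} (σ : P.Strategy) (v : V) : P.Strategy where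
  move w u := σ.move (v :: w) u
  edge w u := σ.edge (v :: w) u

theorem next_shift (P : MDP V) (σ : P.Strategy) (v : V) (w : List V) (u : V) :
    P.next (σ.shift v) w u = P.next σ (v :: w) u := rfl

/-- A vertex followed by a sequence. -/
def consPlay (v : V) (ω : ℕ → V) : ℕ → V
  | 0 => v
  | k + 1 => ω k

theorem edge_of_next_pos (P : MDP V) (σ : P.Strategy) (l : List V) (v w : V)
    (h : P.next σ l v w ≠ 0) : (v, w) ∈ P.E := by
  unfold next at h
  split_ifs at h with hv
  · have : w = σ.move l ⟨v, hv⟩ := by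
      by_contra hne
      exact h (by simp [PMF.pure_apply, hne])
    exact this ▸ σ.edge l ⟨v, hv⟩
  · exact (P.mem_E_iff ⟨v, hv⟩ w).2 (pos_iff_ne_zero.2 h)

theorem next_pos_of_random (P : MDP V) (σ : P.Strategy) (l : List V) (v w : V)
    (hv : v ∉ P.V1) (h : (v, w) ∈ P.E) : P.next σ l v w ≠ 0 := by
  unfold next
  rw [dif_neg hv]
  exact ((P.mem_E_iff ⟨v, hv⟩ w).1 h).ne'

theorem measurable_consPlay [MeasurableSpace V] (v : V) : Measurable (consPlay v) := by
  refine measurable_pi_lambda _ fun k => ?_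
  cases k with
  | zero => exact measurable_const
  | succ k => exact measurable_pi_apply k

theorem cylinder_eq_preimage (a : ℕ → V) (k : ℕ) :
    cylinder a k = Preorder.frestrictLe (π := fun _ => V) k ⁻¹' {fun i : Finset.Iic k => a i} := by
  ext ω
  simp only [cylinder, Set.mem_ofPred_eq, Set.mem_preimage, Set.mem_singleton_iff, funext_iff,
    Subtype.forall, Finset.mem_Iic, Preorder.frestrictLe_apply]

theorem sum_next [Fintype V] (P : MDP V) (σ : P.Strategy) (l : List V) (v : V) :
    ∑ w, P.next σ l v w = 1 := by
  rw [← tsum_fintype (L := .unconditional V)]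
  exact PMF.tsum_coe _

section Law

variable [Fintype V] [MeasurableSpace V] [DiscreteMeasurableSpace V] (P : MDP V) (σ : P.Strategy)

instance (v : V) : IsProbabilityMeasure (P.law σ v) := by
  unfold law; infer_instance

theorem measurableSet_cylinder (a : ℕ → V) (k : ℕ) : MeasurableSet (cylinder a k) := by
  rw [cylinder_eq_preimage]
  exact measurableSet_preimage (Preorder.measurable_frestrictLe (X := fun _ : ℕ => V) _)
    (MeasurableSet.singleton _)

theorem law_cylinder_zero (v : V) (a : ℕ → V) [Decidable (a 0 = v)] :
    P.law σ v (cylinder a 0) = if a 0 = v then 1 else 0 := by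
  have h := congrArg (fun μ : Measure (Finset.Iic 0 → V) => μ {fun i : Finset.Iic 0 => a i})
    (Kernel.traj_map_frestrictLe_apply (X := fun _ => V) (κ := fun n => P.stepKernel σ n) 0 0
      (fun _ => v))
  rw [Kernel.partialTraj_self, Kernel.id_apply] at h
  rw [Measure.map_apply (by fun_prop) (by measurability), ← cylinder_eq_preimage] at h
  rw [law, h, Measure.dirac_apply' _ (by measurability)]
  split_ifs with hv
  · refine Set.indicator_of_mem (Set.mem_singleton_iff.2 (funext fun i => ?_)) _
    rw [← hv, Nat.le_zero.1 (Finset.mem_Iic.1 i.2)]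
  · exact Set.indicator_of_notMem (fun H => hv
      (congrFun (Set.mem_singleton_iff.1 H) (⟨0, by simp⟩ : Finset.Iic 0)).symm) _

/-- The joint law of the coordinates up to `k` and the next one is the composition product of the
marginal with the step kernel; it is evaluated on a product of two singletons. -/
theorem law_cylinder_succ (v : V) (a : ℕ → V) (k : ℕ) :
    P.law σ v (cylinder a (k + 1)) = P.law σ v (cylinder a k) *
      P.next σ (List.ofFn fun i : Fin k => a i) (a k) (a (k + 1)) := by
  have h := congrArg (fun μ : Measure ((Finset.Iic k → V) × V) =>
      μ ({fun i : Finset.Iic k => a i} ×ˢ {a (k + 1)}))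
    (Kernel.partialTraj_compProd_eq_map_traj (X := fun _ => V) (κ := fun n => P.stepKernel σ n)
      (Nat.zero_le k) (x₀ := fun _ => v))
  rw [Measure.compProd_apply_prod (by measurability) (by measurability),
    Measure.map_apply (by fun_prop) (by measurability), lintegral_singleton,
    ← Kernel.traj_map_frestrictLe_apply, Measure.map_apply (by fun_prop) (by measurability),
    ← cylinder_eq_preimage] at h
  have hc : cylinder a (k + 1) = (fun x : ℕ → V => (Preorder.frestrictLe (π := fun _ => V) k x,
      x (k + 1))) ⁻¹' ({fun i : Finset.Iic k => a i} ×ˢ {a (k + 1)}) := by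
    ext ω
    simp only [cylinder, Set.mem_ofPred_eq, Set.mem_preimage, Set.mem_prod, Set.mem_singleton_iff,
      funext_iff, Subtype.forall, Finset.mem_Iic, Preorder.frestrictLe_apply]
    exact ⟨fun H => ⟨fun i hi => H i (by omega), H _ le_rfl⟩, fun H i hi => by
      rcases Nat.lt_or_ge k i with hk | hk
      · obtain rfl : i = k + 1 := by omega
        exact H.2
      · exact H.1 i hk⟩
  rw [law, hc, ← h, mul_comm]
  congr 1
  exact (PMF.toMeasure_apply_singleton _ _ (by measurability))

/-- A measure on sequences is the unique projective limit of its marginals, and on finite products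
of the finite set `V` a measure is determined by singletons, whose preimages are cylinders.
Marginals from some index on suffice, so cylinders of positive index are enough. -/
theorem ext_of_cylinder {μ ν : Measure (ℕ → V)} [IsFiniteMeasure μ] [IsFiniteMeasure ν]
    (h : ∀ a k, μ (cylinder a (k + 1)) = ν (cylinder a (k + 1))) : μ = ν := by
  have hproj : IsProjectiveMeasureFamily (α := fun _ : ℕ => V)
      (fun I : Finset ℕ => ν.map I.restrict) := by
    intro I J hJI
    simp only
    rw [Measure.map_map (by fun_prop) (by fun_prop)]
    rfl
  have hν : IsProjectiveLimit ν (fun I : Finset ℕ => ν.map I.restrict) := fun I => rfl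
  refine IsProjectiveLimit.unique (α := fun _ : ℕ => V)
    (P := fun I : Finset ℕ => ν.map I.restrict) ?_ hν
  rw [isProjectiveLimit_nat_iff' hproj _ 1]
  intro n hn
  obtain ⟨k, rfl⟩ : ∃ k, n = k + 1 := ⟨n - 1, by omega⟩
  refine Measure.ext_of_singleton fun b => ?_
  change _ = (ν.map (Preorder.frestrictLe (π := fun _ => V) (k + 1))) {b}
  rw [Measure.map_apply (by fun_prop) (by measurability),
    Measure.map_apply (by fun_prop) (by measurability)]
  obtain ⟨a, rfl⟩ : ∃ a : ℕ → V, b = fun i : Finset.Iic (k + 1) => a i :=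
    ⟨fun j => if hj : j ∈ Finset.Iic (k + 1) then b ⟨j, hj⟩ else b ⟨0, by simp⟩, by
      funext i
      have hi := i.2
      simp only [hi, dite_true, Subtype.coe_eta]⟩
  rw [← cylinder_eq_preimage]
  exact h _ _

/-- Both sides are the same product of transition probabilities, split off at the first factor
instead of the last. If the cylinder does not start in `v`, both sides vanish. -/
theorem law_cylinder_shift (v : V) (a : ℕ → V) (k : ℕ) :
    P.law σ v (cylinder a (k + 1)) = P.law σ v (cylinder a 0) * (P.next σ [] v (a 1) *
      P.law (σ.shift v) (a 1) (cylinder (fun i => a (i + 1)) k)) := by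
  classical
  by_cases hv : a 0 = v
  swap
  · have h0 : P.law σ v (cylinder a 0) = 0 := by rw [law_cylinder_zero, if_neg hv]
    rw [h0, zero_mul]
    exact measure_mono_null (cylinder_subset _ (Nat.zero_le _)) h0
  induction k with
  | zero =>
    rw [law_cylinder_succ, law_cylinder_zero (P := P) (σ := σ.shift v)]
    simp [hv]
  | succ k ih =>
    rw [law_cylinder_succ, ih, law_cylinder_succ _ _ _ _ k, next_shift, List.ofFn_succ]
    simp only [Fin.val_zero, Fin.val_succ, hv, mul_assoc]

/-- The play after its first step follows the shifted strategy. -/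
theorem law_eq_sum (v : V) : P.law σ v =
    ∑ w, P.next σ [] v w • (P.law (σ.shift v) w).map (consPlay v) := by
  classical
  have hfin : IsFiniteMeasure (∑ w, P.next σ [] v w •
      (P.law (σ.shift v) w).map (consPlay v)) := by
    refine ⟨?_⟩
    rw [Measure.finsetSum_apply]
    refine ENNReal.sum_lt_top.2 fun w _ => ?_
    rw [Measure.smul_apply, smul_eq_mul]
    exact ENNReal.mul_lt_top (PMF.apply_lt_top _ _) (measure_lt_top _ _)
  refine ext_of_cylinder fun a k => ?_
  have hmeas := measurableSet_cylinder a (k + 1)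
  rw [Measure.finsetSum_apply]
  simp only [Measure.smul_apply, smul_eq_mul, Measure.map_apply (measurable_consPlay v) hmeas]
  rw [law_cylinder_shift, law_cylinder_zero]
  by_cases hv : a 0 = v
  · have hpre : consPlay v ⁻¹' cylinder a (k + 1) = cylinder (fun i => a (i + 1)) k := by
      ext ω
      refine ⟨fun H i hi => H (i + 1) (by omega), fun H i hi => ?_⟩
      cases i with
      | zero => exact hv.symm
      | succ i => exact H i (by omega)
    rw [if_pos hv, one_mul, hpre, Finset.sum_eq_single (a 1)]
    · intro w _ hw
      have h0 : P.law (σ.shift v) w (cylinder (fun i => a (i + 1)) 0) = 0 := by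
        rw [law_cylinder_zero, if_neg (Ne.symm hw)]
      rw [measure_mono_null (cylinder_subset _ (Nat.zero_le _)) h0, mul_zero]
    · simp
  · have hpre : consPlay v ⁻¹' cylinder a (k + 1) = ∅ :=
      Set.eq_empty_of_forall_notMem fun ω H => hv (H 0 (by omega)).symm
    simp [hv, hpre]

theorem law_apply (v : V) {Φ : Set (ℕ → V)} (hΦ : MeasurableSet Φ) : P.law σ v Φ =
    ∑ w, P.next σ [] v w * P.law (σ.shift v) w (consPlay v ⁻¹' Φ) := by
  conv_lhs => rw [law_eq_sum]
  rw [Measure.finsetSum_apply]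
  simp only [Measure.smul_apply, smul_eq_mul, Measure.map_apply (measurable_consPlay v) hΦ]

end Law

end MDP

/-! ### Paths inside a set of vertices. -/

/-- `Leads E A B v`: there is a path from `v` to a vertex of `B` in the graph induced by `A`. -/
inductive Leads {V : Type*} (E : Set (V × V)) (A B : Set V) : V → Prop where
  | base {v} : v ∈ A → v ∈ B → Leads E A B v
  | step {v w} : v ∈ A → (v, w) ∈ E → Leads E A B w → Leads E A B v

theorem Leads.mono {V : Type*} {E : Set (V × V)} {A A' B B' : Set V} (hA : A ⊆ A')
    (hB : ∀ v ∈ A, v ∈ B → v ∈ B') {v : V} (h : Leads E A B v) : Leads E A' B' v := by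
  induction h with
  | base hv hb => exact .base (hA hv) (hB _ hv hb)
  | step hv he _ ih => exact .step (hA hv) he ih

theorem Leads.trans {V : Type*} {E : Set (V × V)} {A B C : Set V}
    (h : ∀ v ∈ A, v ∈ B → Leads E A C v) {v : V} (hv : Leads E A B v) : Leads E A C v := by
  induction hv with
  | base hv hb => exact h _ hv hb
  | step hv he _ ih => exact .step hv he ih

theorem Leads.mem {V : Type*} {E : Set (V × V)} {A B : Set V} {v : V} (h : Leads E A B v) :
    v ∈ A := by
  cases h <;> assumption

/-- A path of length `k` from `v` to `B` in the graph induced by `A`. -/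
def LeadsIn {V : Type*} (E : Set (V × V)) (A B : Set V) : ℕ → V → Prop
  | 0, v => v ∈ A ∧ v ∈ B
  | k + 1, v => v ∈ A ∧ ∃ w, (v, w) ∈ E ∧ LeadsIn E A B k w

theorem Leads.exists_leadsIn {V : Type*} {E : Set (V × V)} {A B : Set V} {v : V}
    (h : Leads E A B v) : ∃ k, LeadsIn E A B k v := by
  induction h with
  | base hv hb => exact ⟨0, hv, hb⟩
  | step hv he _ ih => exact ih.imp' (· + 1) fun k hk => ⟨hv, _, he, hk⟩

theorem LeadsIn.mem {V : Type*} {E : Set (V × V)} {A B : Set V} {v : V} {k : ℕ}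
    (h : LeadsIn E A B k v) : v ∈ A := by
  cases k <;> exact h.1

/-- Along a shortest path the distance to `B` decreases. -/
theorem exists_rank {V : Type*} {E : Set (V × V)} {A B : Set V} (h : ∀ v ∈ A, Leads E A B v) :
    ∃ d : V → ℕ, ∀ v ∈ A, v ∉ B → ∃ w ∈ A, (v, w) ∈ E ∧ d w < d v := by
  classical
  refine ⟨fun v => sInf {k | LeadsIn E A B k v}, fun v hv hB => ?_⟩
  have hmem : sInf {k | LeadsIn E A B k v} ∈ {k | LeadsIn E A B k v} :=
    Nat.sInf_mem (h v hv).exists_leadsIn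
  beta_reduce
  generalize sInf {k | LeadsIn E A B k v} = k at hmem ⊢
  cases k with
  | zero => exact absurd hmem.2 hB
  | succ k =>
    obtain ⟨_, w, he, hw⟩ := hmem
    exact ⟨w, hw.mem, he, Nat.lt_succ_of_le (Nat.sInf_le hw)⟩

/-! ### The almost-sure winning set as a largest closed set. -/

namespace MDP

variable {V : Type*}

theorem nonempty_strategy (P : MDP V) : Nonempty P.Strategy := by
  choose f hf using P.exists_out
  exact ⟨⟨fun _ v => f v, fun _ v => hf v⟩⟩

theorem measurableSet_of_coord [MeasurableSpace V] [DiscreteMeasurableSpace V] (S : Set V)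
    (k : ℕ) : MeasurableSet {ω : ℕ → V | ω k ∈ S} :=
  measurable_pi_apply k (MeasurableSet.of_discrete (s := S))

/-- The sequences that avoid `T`. -/
def miss (T : Set V) : Set (ℕ → V) := {ω | ∀ k, ω k ∈ Tᶜ}

theorem measurableSet_miss [MeasurableSpace V] [DiscreteMeasurableSpace V] (T : Set V) :
    MeasurableSet (miss T) := by
  have : miss T = ⋂ k, {ω : ℕ → V | ω k ∈ Tᶜ} := by ext ω; simp [miss]
  rw [this]
  exact MeasurableSet.iInter fun k => measurableSet_of_coord _ _

variable [Fintype V] [MeasurableSpace V] [DiscreteMeasurableSpace V] (P : MDP V)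

theorem measurableSet_of_coords (S : Set (V × V)) (k : ℕ) :
    MeasurableSet {ω : ℕ → V | (ω k, ω (k + 1)) ∈ S} :=
  ((measurable_pi_apply k).prodMk (measurable_pi_apply (k + 1))) S.toFinite.measurableSet

theorem law_start (σ : P.Strategy) (v : V) {S : Set V} (hS : v ∉ S) :
    P.law σ v {ω | ω 0 ∈ S} = 0 := by
  classical
  have h := P.law_cylinder_zero σ v (fun _ => v)
  rw [if_pos rfl, ← prob_compl_eq_zero_iff (measurableSet_cylinder _ _)] at h
  refine measure_mono_null (fun ω hω => ?_) h
  intro H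
  have h0 : ω 0 = v := H 0 le_rfl
  exact hS (h0 ▸ hω)

theorem law_edge (k : ℕ) : ∀ (σ : P.Strategy) (v : V),
    P.law σ v {ω | (ω k, ω (k + 1)) ∈ P.Eᶜ} = 0 := by
  induction k with
  | zero =>
    intro σ v
    rw [law_apply _ _ _ (measurableSet_of_coords _ _)]
    refine Finset.sum_eq_zero fun w _ => ?_
    by_cases hw : P.next σ [] v w = 0
    · rw [hw, zero_mul]
    · exact mul_eq_zero_of_right _ (P.law_start (σ.shift v) w (S := {u | (v, u) ∈ P.Eᶜ})
        (fun H => H (P.edge_of_next_pos σ _ v w hw)))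
  | succ k ih =>
    intro σ v
    rw [law_apply _ _ _ (measurableSet_of_coords _ _)]
    exact Finset.sum_eq_zero fun w _ => mul_eq_zero_of_right _ (ih _ _)

/-- Each single step is almost surely an edge, so the requirement in `Reach` that the sequence be a
path only costs a countable union of null sets. -/
theorem law_reach_eq_one_iff (σ : P.Strategy) (v : V) (T : Set V) :
    P.law σ v (P.Reach T) = 1 ↔ P.law σ v (miss T) = 0 := by
  have hplays : P.law σ v (⋃ k, {ω | (ω k, ω (k + 1)) ∈ P.Eᶜ}) = 0 :=
    measure_iUnion_null fun k => P.law_edge k σ v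
  have hc : (P.Reach T)ᶜ = (⋃ k, {ω | (ω k, ω (k + 1)) ∈ P.Eᶜ}) ∪ miss T := by
    ext ω
    simp only [Reach, plays, miss, Set.mem_compl_iff, Set.mem_ofPred_eq, Set.mem_union,
      Set.mem_iUnion, not_and_or, not_forall, not_exists]
  have hm : MeasurableSet (P.Reach T) := by
    rw [← compl_compl (P.Reach T), hc]
    exact ((MeasurableSet.iUnion fun k => measurableSet_of_coords _ _).union
      (measurableSet_miss T)).compl
  rw [← prob_compl_eq_zero_iff hm, hc]
  exact ⟨fun h => measure_mono_null Set.subset_union_right h, fun h => measure_union_null hplays h⟩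

theorem mem_asw_iff (T : Set V) (v : V) :
    v ∈ P.ASW (P.Reach T) ↔ ∃ σ, P.law σ v (miss T) = 0 :=
  exists_congr fun σ => P.law_reach_eq_one_iff σ v T

theorem law_miss_of_mem (σ : P.Strategy) {T : Set V} {v : V} (hv : v ∈ T) :
    P.law σ v (miss T) = 0 :=
  measure_mono_null (fun _ h => h 0) (P.law_start σ v (S := Tᶜ) (fun h => h hv))

theorem law_miss_of_notMem (σ : P.Strategy) {T : Set V} {v : V} (hv : v ∉ T) :
    P.law σ v (miss T) = ∑ w, P.next σ [] v w * P.law (σ.shift v) w (miss T) := by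
  rw [law_apply _ _ _ (measurableSet_miss T)]
  have : consPlay v ⁻¹' miss T = miss T := by
    ext ω
    refine ⟨fun h k => h (k + 1), fun h k => ?_⟩
    cases k with
    | zero => exact hv
    | succ k => exact h k
  rw [this]

theorem law_miss_shift (σ : P.Strategy) {T : Set V} {v w : V} (hv : v ∉ T)
    (h : P.law σ v (miss T) = 0) (hw : P.next σ [] v w ≠ 0) :
    P.law (σ.shift v) w (miss T) = 0 := by
  rw [P.law_miss_of_notMem σ hv, Finset.sum_eq_zero_iff] at h
  exact (mul_eq_zero.1 (h w (Finset.mem_univ w))).resolve_left hw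

theorem subset_asw_reach (T : Set V) : T ⊆ P.ASW (P.Reach T) := fun v hv =>
  (P.mem_asw_iff T v).2 (P.nonempty_strategy.elim fun σ => ⟨σ, P.law_miss_of_mem σ hv⟩)

theorem asw_reach_random {T : Set V} {v w : V} (hv : v ∈ P.ASW (P.Reach T)) (hR : v ∈ P.VR)
    (hT : v ∉ T) (he : (v, w) ∈ P.E) : w ∈ P.ASW (P.Reach T) := by
  obtain ⟨σ, hσ⟩ := (P.mem_asw_iff T v).1 hv
  exact (P.mem_asw_iff T w).2
    ⟨σ.shift v, P.law_miss_shift σ hT hσ (P.next_pos_of_random σ [] v w hR he)⟩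

/-- Before `T` is hit, each vertex entered with positive probability is again winning, with the
shifted strategy as witness. A visit to `T` at time `k` with positive probability would therefore
trace a path inside the winning set. -/
theorem law_hit_eq_zero (T : Set V) (k : ℕ) : ∀ (σ : P.Strategy) (v : V),
    P.law σ v (miss T) = 0 → ¬ Leads P.E (P.ASW (P.Reach T)) T v →
    P.law σ v {ω | ω k ∈ T} = 0 := by
  induction k with
  | zero =>
    intro σ v hσ hv
    exact P.law_start σ v fun hT => hv (.base ((P.mem_asw_iff T v).2 ⟨σ, hσ⟩) hT)
  | succ k ih =>
    intro σ v hσ hv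
    have hW := (P.mem_asw_iff T v).2 ⟨σ, hσ⟩
    rw [law_apply _ _ _ (measurableSet_of_coord _ _)]
    refine Finset.sum_eq_zero fun w _ => ?_
    by_cases hw : P.next σ [] v w = 0
    · rw [hw, zero_mul]
    · exact mul_eq_zero_of_right _ (ih _ _ (P.law_miss_shift σ (fun hT => hv (.base hW hT)) hσ hw)
        fun hl => hv (.step hW (P.edge_of_next_pos σ _ v w hw) hl))

/-- Without such a path, missing `T` and hitting `T` at any fixed time would all be null events, yet
together they exhaust the space. -/
theorem asw_reach_leads {T : Set V} {v : V} (hv : v ∈ P.ASW (P.Reach T)) :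
    Leads P.E (P.ASW (P.Reach T)) T v := by
  by_contra hl
  obtain ⟨σ, hσ⟩ := (P.mem_asw_iff T v).1 hv
  have h0 : P.law σ v (miss T ∪ ⋃ k, {ω | ω k ∈ T}) = 0 :=
    measure_union_null hσ (measure_iUnion_null fun k => P.law_hit_eq_zero T k σ v hσ hl)
  have hu : miss T ∪ ⋃ k, {ω : ℕ → V | ω k ∈ T} = Set.univ := by
    refine Set.eq_univ_of_forall fun ω => ?_
    by_cases h : ∃ k, ω k ∈ T
    · exact Or.inr (Set.mem_iUnion.2 h)
    · exact Or.inl fun k hk => h ⟨k, hk⟩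
  rw [hu, measure_univ] at h0
  exact one_ne_zero h0

/-- A set in which the random vertices outside `T` are closed under successors, and from which `T`
can be reached without leaving it, is almost-sure winning. -/
theorem subset_asw_of_closed {T A : Set V}
    (hR : ∀ v ∈ A, v ∈ P.VR → v ∉ T → ∀ w, (v, w) ∈ P.E → w ∈ A)
    (hL : ∀ v ∈ A, Leads P.E A T v) : A ⊆ P.ASW (P.Reach T) := by
  classical
  obtain ⟨d, hd⟩ := exists_rank hL
  have hf : ∀ v, ∃ w, (v, w) ∈ P.E ∧ (v ∈ A → v ∉ T → w ∈ A ∧ d w < d v) := by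
    intro v
    by_cases h : v ∈ A ∧ v ∉ T
    · obtain ⟨w, hw, he, hlt⟩ := hd v h.1 h.2
      exact ⟨w, he, fun _ _ => ⟨hw, hlt⟩⟩
    · obtain ⟨w, he⟩ := P.exists_out v
      exact ⟨w, he, fun h1 h2 => absurd ⟨h1, h2⟩ h⟩
  choose f hfe hfd using hf
  let σ : P.Strategy := ⟨fun _ v => f v, fun _ v => hfe v⟩
  -- The strategy ignores the history, so the miss probability depends on the current vertex only.
  have hshift : ∀ v, σ.shift v = σ := fun v => rfl
  have hnext : ∀ v ∈ A, v ∉ T → ∀ w, P.next σ [] v w ≠ 0 → w ∈ A := by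
    intro v hv hT w hw
    by_cases h1 : v ∈ P.V1
    · have : w = f v := by
        by_contra hne
        apply hw
        rw [next, dif_pos h1]
        simp [σ, hne]
      exact this ▸ (hfd v hv hT).1
    · exact hR v hv h1 hT w (P.edge_of_next_pos σ _ v w hw)
  have hdec : ∀ v ∈ A, v ∉ T → ∃ w ∈ A, P.next σ [] v w ≠ 0 ∧ d w < d v := by
    intro v hv hT
    by_cases h1 : v ∈ P.V1
    · refine ⟨f v, (hfd v hv hT).1, ?_, (hfd v hv hT).2⟩
      rw [next, dif_pos h1]
      simp [σ]
    · obtain ⟨w, hw, he, hlt⟩ := hd v hv hT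
      exact ⟨w, hw, P.next_pos_of_random σ _ v w h1 he, hlt⟩
  let g : V → ℝ := fun v => (P.law σ v (miss T)).toReal
  have hharm : ∀ v, v ∉ T → g v = ∑ w, (P.next σ [] v w).toReal * g w := by
    intro v hT
    simp only [g]
    rw [P.law_miss_of_notMem σ hT, ENNReal.toReal_sum]
    · simp only [ENNReal.toReal_mul, hshift]
    · exact fun w _ => ENNReal.mul_ne_top (PMF.apply_ne_top _ _) (measure_ne_top _ _)
  have hone : ∀ v, ∑ w, (P.next σ [] v w).toReal = 1 := by
    intro v
    rw [← ENNReal.toReal_sum fun w _ => PMF.apply_ne_top _ _, P.sum_next σ [] v,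
      ENNReal.toReal_one]
  intro v₀ hv₀
  refine (P.mem_asw_iff T v₀).2 ⟨σ, ?_⟩
  -- Maximum principle: `g` is an average over successors outside `T`, so at a vertex where it is
  -- maximal on `A` each successor of positive probability also attains the maximum. Following the
  -- decreasing rank ends in `T`, where `g` vanishes.
  obtain ⟨u, hu, hmax⟩ := A.toFinite.exists_maximalFor g A ⟨v₀, hv₀⟩
  have hle : ∀ v ∈ A, g v ≤ g u := fun v hv => by
    rcases le_total (g v) (g u) with h | h
    · exact h
    · exact hmax hv h
  have key : ∀ k, ∀ v ∈ A, d v = k → g v = g u → g u = 0 := by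
    intro k
    induction k using Nat.strong_induction_on with
    | _ k ih =>
      intro v hv hk hg
      by_cases hT : v ∈ T
      · rw [← hg]
        simp [g, P.law_miss_of_mem σ hT]
      obtain ⟨w, hw, hp, hlt⟩ := hdec v hv hT
      refine ih (d w) (hk ▸ hlt) w hw rfl ?_
      have hsum : ∑ x, (P.next σ [] v x).toReal * (g u - g x) = 0 := by
        simp only [mul_sub, Finset.sum_sub_distrib, ← Finset.sum_mul, hone, one_mul]
        rw [← hharm v hT, hg, sub_self]
      rw [Finset.sum_eq_zero_iff_of_nonneg] at hsum
      · have := (mul_eq_zero.1 (hsum w (Finset.mem_univ w))).resolve_left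
          (ENNReal.toReal_ne_zero.2 ⟨hp, PMF.apply_ne_top _ _⟩)
        linarith
      · intro x _
        by_cases hx : P.next σ [] v x = 0
        · simp [hx]
        · exact mul_nonneg ENNReal.toReal_nonneg (sub_nonneg.2 (hle x (hnext v hv hT x hx)))
  have h0 : g v₀ ≤ 0 := (hle v₀ hv₀).trans (key _ u hu rfl rfl).le
  have h1 : g v₀ = 0 := le_antisymm h0 ENNReal.toReal_nonneg
  exact (ENNReal.toReal_eq_zero_iff _).1 h1 |>.resolve_right (measure_ne_top _ _)

end MDP

/-! ### A program logic for total correctness. -/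

namespace Symbolic

/-- The part of a configuration that matters for the verification of programs which never write
sets of edges. A cell that stores no set is identified with one that stores the empty set. -/
structure Conf (V : Type*) where
  num : ℕ → ℕ
  vs : ℕ → Set V
  ops : ℕ

/-- The parameters of an execution: the picker, the bound for the addresses of sets of vertices,
and the set of edges in the edge-set cell `0`. -/
structure Env (V : Type*) where
  ρ : Picker V
  B : ℕ
  E : Set (V × V)

variable {V : Type*}

/-- The relevant part of a configuration. -/
def State.conf (s : State V) : Conf V := ⟨s.num, fun i => (s.vset i).getD ∅, s.ops⟩

/-- The sets of vertices are stored below the bound, and only one set of edges is stored. -/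
structure Env.Fits (cx : Env V) (s : State V) : Prop where
  vset : ∀ i, cx.B ≤ i → s.vset i = none
  eset : ∀ i, i ≠ 0 → s.eset i = none
  edges : s.eset 0 = some cx.E
  peak : s.peak ≤ (cx.B + 1 : ℕ)

/-- The total correctness assertion for the program `p` started in `c`. -/
def Run (cx : Env V) (p : Prog) (c : Conf V) (Q : Conf V → Prop) : Prop :=
  ∀ s, cx.Fits s → s.conf = c → ∃ t, Exec cx.ρ p s t ∧ cx.Fits t ∧ Q t.conf

/-- Space is controlled statically: sets of vertices lie below the address `B` and the input is the
only set of edges, so no program has to be analysed for its peak. -/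
theorem stored_le {B : ℕ} {s : State V} (hv : ∀ i, B ≤ i → s.vset i = none)
    (he : ∀ i, i ≠ 0 → s.eset i = none) : s.stored ≤ (B + 1 : ℕ) := by
  have h1 : {i | s.vset i ≠ none}.encard ≤ B := by
    refine (Set.encard_le_encard (t := (Finset.range B : Set ℕ)) fun i hi => ?_).trans ?_
    · by_contra h
      exact hi (hv i (by simpa using h))
    · rw [Set.encard_coe_eq_coe_finsetCard, Finset.card_range]
  have h2 : {i | s.eset i ≠ none}.encard ≤ 1 := by
    refine (Set.encard_le_encard (t := {0}) fun i hi => ?_).trans (Set.encard_singleton _).le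
    by_contra h
    exact hi (he i (by simpa using h))
  calc s.stored ≤ B + 1 := add_le_add h1 h2
    _ = ((B + 1 : ℕ) : ℕ∞) := by norm_cast

theorem Env.Fits.putN {cx : Env V} {s : State V} (h : cx.Fits s) (a : Expr) (k : ℕ) :
    cx.Fits (s.putN a k) := ⟨h.vset, h.eset, h.edges, h.peak⟩

theorem Env.Fits.putV {cx : Env V} {s : State V} (h : cx.Fits s) (a : Expr) (A : Option (Set V))
    (ha : s.val a < cx.B) : cx.Fits (s.putV a A) := by
  refine ⟨fun i hi => ?_, h.eset, h.edges, h.peak⟩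
  have : i ≠ s.val a := by omega
  simp only [State.putV, Function.update_of_ne this]
  exact h.vset i hi

theorem Env.Fits.track {cx : Env V} {s : State V} (h : cx.Fits s) (k : ℕ) :
    cx.Fits { s.track with ops := k } :=
  ⟨h.vset, h.eset, h.edges, max_le h.peak (stored_le h.vset h.eset)⟩

variable {cx : Env V} {c : Conf V} {p q : Prog} {Q : Conf V → Prop}

theorem Run.mono {Q' : Conf V → Prop} (h : Run cx p c Q) (hQ : ∀ c', Q c' → Q' c') :
    Run cx p c Q' := fun s hs hc =>
  let ⟨t, h1, h2, h3⟩ := h s hs hc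
  ⟨t, h1, h2, hQ _ h3⟩

theorem Run.skip (h : Q c) : Run cx .skip c Q := fun s hs hc => ⟨s, .skip s, hs, hc ▸ h⟩

theorem Run.seq (h : Run cx p c fun c' => Run cx q c' Q) : Run cx (.seq p q) c Q := by
  intro s hs hc
  obtain ⟨t, h1, h2, h3⟩ := h s hs hc
  obtain ⟨u, h4, h5, h6⟩ := h3 t h2 rfl
  exact ⟨u, .seq h1 h4, h5, h6⟩

theorem Run.ite {b : Expr} (h1 : b.eval c.num ≠ 0 → Run cx p c Q)
    (h0 : b.eval c.num = 0 → Run cx q c Q) : Run cx (.ite b p q) c Q := by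
  intro s hs hc
  by_cases hb : b.eval c.num = 0
  · obtain ⟨t, h3, h4⟩ := h0 hb s hs hc
    exact ⟨t, .ite_false (by subst hc; exact hb) h3, h4⟩
  · obtain ⟨t, h3, h4⟩ := h1 hb s hs hc
    exact ⟨t, .ite_true (by subst hc; exact hb) h3, h4⟩

theorem Run.loop {b : Expr} (I : Conf V → Prop) (m : Conf V → ℕ)
    (step : ∀ c, I c → b.eval c.num ≠ 0 → Run cx p c fun c' => I c' ∧ m c' < m c)
    (done : ∀ c, I c → b.eval c.num = 0 → Q c) (hc : I c) : Run cx (.loop b p) c Q := by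
  induction hk : m c using Nat.strong_induction_on generalizing c with
  | _ k ih =>
    intro s hs hsc
    by_cases hb : b.eval c.num = 0
    · exact ⟨s, .loop_done (by subst hsc; exact hb), hs, hsc ▸ done c hc hb⟩
    · obtain ⟨t, h1, h2, h3, h4⟩ := step c hc hb s hs hsc
      obtain ⟨u, h5, h6⟩ := ih (m t.conf) (hk ▸ h4) h3 rfl t h2 rfl
      exact ⟨u, .loop_step (by subst hsc; exact hb) h1 h5, h6⟩

theorem Run.assign {a e : Expr}
    (h : Q { c with num := Function.update c.num (a.eval c.num) (e.eval c.num) }) :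
    Run cx (.assign a e) c Q := by
  intro s hs hc
  subst hc
  exact ⟨_, .assign a e s, hs.putN _ _, h⟩

theorem conf_putV (s : State V) (a : Expr) (A : Set V) :
    (s.putV a (some A)).conf = { s.conf with
      vs := Function.update s.conf.vs (a.eval s.num) A } := by
  simp only [State.conf, State.putV, State.val]
  congr 1
  funext i
  by_cases hi : i = a.eval s.num
  · subst hi; simp
  · simp [Function.update_of_ne hi]

/-- The result is a function of the full state because `pre` and `post` read the edge cell, which
`Conf` omits; `Fits` supplies its content. -/
theorem Run.op_putV {o : Op} {a : Expr} {f : State V → Set V}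
    (ho : ∀ s : State V, s.effect cx.ρ o = s.putV a (some (f s))) (ha : a.eval c.num < cx.B)
    (h : ∀ s, cx.Fits s → s.conf = c →
      Q { c with vs := Function.update c.vs (a.eval c.num) (f s), ops := c.ops + 1 }) :
    Run cx (.op o) c Q := by
  intro s hs hc
  refine ⟨_, .op o s, ?_, ?_⟩
  · rw [State.perform, ho]
    exact (hs.putV a _ (by subst hc; exact ha)).track _
  · have hq := h s hs hc
    subst hc
    rw [State.perform, ho]
    have := conf_putV s a (f s)
    simp only [State.conf, State.track, Conf.mk.injEq] at this hq ⊢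
    rw [this.1, this.2.1]
    exact hq

theorem Run.op_putN {o : Op} {a : Expr} {f : State V → ℕ}
    (ho : ∀ s : State V, s.effect cx.ρ o = s.putN a (f s))
    (h : ∀ s, s.conf = c →
      Q { c with num := Function.update c.num (a.eval c.num) (f s), ops := c.ops + 1 }) :
    Run cx (.op o) c Q := by
  intro s hs hc
  refine ⟨_, .op o s, ?_, ?_⟩
  · rw [State.perform, ho]
    exact (hs.putN a _).track _
  · have hq := h s hc
    subst hc
    rw [State.perform, ho]
    exact hq

theorem Run.vertexOp {o : SetOp} {d x y : Expr} (hd : d.eval c.num < cx.B)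
    (h : Q { c with
          vs := Function.update c.vs (d.eval c.num)
            (o.apply (c.vs (x.eval c.num)) (c.vs (y.eval c.num))), ops := c.ops + 1 }) :
    Run cx (.op (.vertexOp o d x y)) c Q :=
  Run.op_putV (fun _ => rfl) hd fun s _ hs => by subst hs; exact h

theorem Run.pre {d x : Expr} (hd : d.eval c.num < cx.B)
    (h : Q { c with
          vs := Function.update c.vs (d.eval c.num)
            {v | ∃ w ∈ c.vs (x.eval c.num), (v, w) ∈ cx.E}, ops := c.ops + 1 }) :
    Run cx (.op (.pre d (.const 0) x)) c Q :=
  Run.op_putV (fun _ => rfl) hd fun s hf hs => by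
    have : s.getE (.const 0) = cx.E := by simp [State.getE, State.val, Expr.eval, hf.edges]
    rw [this]; subst hs; exact h

theorem Run.post {d x : Expr} (hd : d.eval c.num < cx.B)
    (h : Q { c with
          vs := Function.update c.vs (d.eval c.num)
            {w | ∃ v ∈ c.vs (x.eval c.num), (v, w) ∈ cx.E}, ops := c.ops + 1 }) :
    Run cx (.op (.post d (.const 0) x)) c Q :=
  Run.op_putV (fun _ => rfl) hd fun s hf hs => by
    have : s.getE (.const 0) = cx.E := by simp [State.getE, State.val, Expr.eval, hf.edges]
    rw [this]; subst hs; exact h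

/-- Quantifying over all vertices of the set makes every later proof independent of the picker. -/
theorem Run.pick {d x : Expr} (hd : d.eval c.num < cx.B) (hx : (c.vs (x.eval c.num)).Nonempty)
    (h : ∀ v ∈ c.vs (x.eval c.num),
      Q { c with vs := Function.update c.vs (d.eval c.num) {v}, ops := c.ops + 1 }) :
    Run cx (.op (.pick d x)) c Q :=
  Run.op_putV (fun _ => rfl) hd fun s _ hs => by
    have hv := cx.ρ.choose_mem s.ops _ hx
    have : {v | v ∈ s.getV x ∧ v = cx.ρ.choose s.ops (s.getV x)} =
        {cx.ρ.choose s.ops (c.vs (x.eval c.num))} := by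
      subst hs
      ext v
      exact ⟨fun H => H.2, fun H => ⟨by rw [Set.mem_singleton_iff.1 H]; exact hv, H⟩⟩
    rw [this]
    exact h _ hv

theorem Run.card {d x : Expr}
    (h : Q { c with num := Function.update c.num (d.eval c.num) (c.vs (x.eval c.num)).ncard,
                    ops := c.ops + 1 }) :
    Run cx (.op (.card d x)) c Q :=
  Run.op_putN (fun _ => rfl) fun s hs => by subst hs; exact h

open Classical in
theorem Run.vertexSubset {d x y : Expr}
    (h : Q { c with
          num := Function.update c.num (d.eval c.num)
            (if c.vs (x.eval c.num) ⊆ c.vs (y.eval c.num) then 1 else 0), ops := c.ops + 1 }) :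
    Run cx (.op (.vertexSubset d x y)) c Q :=
  Run.op_putN (fun _ => rfl) fun s hs => by subst hs; exact h

/-- Run the body for all values of the number cell `i` below `bound`. -/
def forLoop (i : ℕ) (bound : Expr) (body : Prog) : Prog :=
  .seq (.assign (.const i) (.const 0))
    (.loop (.sub bound (.load (.const i)))
      (.seq body (.assign (.const i) (.add (.load (.const i)) (.const 1)))))

/-- The bound is evaluated again on every pass, so the invariant has to fix its value, and the body
has to preserve the counter. -/
theorem Run.forLoop {i N : ℕ} {bound : Expr} {body : Prog} (I : ℕ → Conf V → Prop)
    (bound_eq : ∀ k c, I k c → c.num i = k → bound.eval c.num = N)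
    (start : I 0 { c with num := Function.update c.num i 0 })
    (step : ∀ k c, k < N → c.num i = k → I k c → Run cx body c fun c' => c'.num i = k ∧
      I (k + 1) { c' with num := Function.update c'.num i (k + 1) })
    (done : ∀ c, I N c → Q c) : Run cx (forLoop i bound body) c Q := by
  refine Run.seq (Run.assign ?_)
  refine Run.loop (fun c => c.num i ≤ N ∧ I (c.num i) c) (fun c => N - c.num i) ?_ ?_ ?_
  · rintro c ⟨hle, hI⟩ hb
    simp only [Expr.eval, bound_eq _ c hI rfl] at hb
    refine Run.seq ((step _ c (by omega) rfl hI).mono ?_)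
    rintro c' ⟨h1, h2⟩
    refine Run.assign ?_
    simp only [Expr.eval, h1, Function.update_self]
    exact ⟨⟨by omega, h2⟩, by omega⟩
  · rintro c ⟨hle, hI⟩ hb
    simp only [Expr.eval, bound_eq _ c hI rfl] at hb
    have : c.num i = N := by omega
    exact done c (this ▸ hI)
  · simp only [Expr.eval, Function.update_self]
    exact ⟨Nat.zero_le _, start⟩

/-- Run the body for all vertices of the set in cell `z`, which is consumed, with the current
vertex in cell `x`. -/
def forEach (z x : ℕ) (body : Prog) : Prog :=
  .seq (.op (.card (.const 6) (.const z)))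
    (.loop (.load (.const 6))
      (.seq (.op (.pick (.const x) (.const z)))
        (.seq (.op (.vertexOp .diff (.const z) (.const z) (.const x)))
          (.seq body (.op (.card (.const 6) (.const z)))))))

/-- The invariant is indexed by the set `Z` of vertices still to be treated; its cardinality is the
variant and later carries the amortized cost. A pass costs three operations besides the body. -/
theorem Run.forEach [Finite V] {z x : ℕ} {body : Prog} (I : Set V → Conf V → Prop)
    (hz : z < cx.B) (hx : x < cx.B) (hzx : z ≠ x)
    (start : I (c.vs z) { c with num := Function.update c.num 6 (c.vs z).ncard,
                                 ops := c.ops + 1 })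
    (step : ∀ Z c v, v ∈ Z → c.vs z = Z → I Z c →
      Run cx body { c with vs := Function.update (Function.update c.vs x {v}) z (Z \ {v}),
                           ops := c.ops + 2 } fun c' => c'.vs z = Z \ {v} ∧
        I (Z \ {v}) { c' with num := Function.update c'.num 6 (Z \ {v}).ncard,
                              ops := c'.ops + 1 })
    (done : ∀ c, c.vs z = ∅ → I ∅ c → Q c) : Run cx (forEach z x body) c Q := by
  refine Run.seq (Run.card ?_)
  refine Run.loop (fun c => c.num 6 = (c.vs z).ncard ∧ I (c.vs z) c) (fun c => (c.vs z).ncard)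
    ?_ ?_ ?_
  · rintro c ⟨hn, hI⟩ hb
    simp only [Expr.eval, hn] at hb
    refine Run.seq (Run.pick (by simpa only [Expr.eval] using hx)
      (Set.nonempty_of_ncard_ne_zero hb) fun v hv => ?_)
    refine Run.seq (Run.vertexOp (by simpa only [Expr.eval] using hz) ?_)
    simp only [Expr.eval, SetOp.apply, Function.update_self, Function.update_of_ne hzx]
    refine Run.seq ((step _ c v hv rfl hI).mono ?_)
    rintro c' ⟨h1, h2⟩
    refine Run.card ?_
    simp only [Expr.eval, h1, Function.update_self, true_and]
    exact ⟨h2, Set.ncard_sdiff_singleton_lt_of_mem hv (Set.toFinite _)⟩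
  · rintro c ⟨hn, hI⟩ hb
    simp only [Expr.eval, hn] at hb
    have h0 := (Set.ncard_eq_zero (Set.toFinite _)).1 hb
    exact done c h0 (h0 ▸ hI)
  · simp only [Expr.eval, Function.update_self, true_and]
    exact start

end Symbolic

/-! ### Labels, memory layout and the invariant of the algorithm. -/

namespace Symbolic

/-- The address literal `i`. -/
abbrev lit (i : ℕ) : Expr := .const i

/-- The content of the number cell `i`. -/
abbrev cell (i : ℕ) : Expr := .load (.const i)

/-- The address of the entry with index `e` of the array of numbers that starts at `k`; the arrays
that start at `32, 33, 34, 35` are interleaved. -/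
abbrev entry (k : ℕ) (e : Expr) : Expr := .add (.mul (.const 4) e) (.const k)

/-- The address of the set of the vertices in whose label the bit number `e` is set. -/
abbrev bitCell (e : Expr) : Expr := .add (.const 16) e

/-- Store the label of the vertex in the vertex-set cell `x` in the number cell `5`. -/
def labelProg (x : ℕ) : Prog :=
  .seq (.assign (lit 5) (lit 0))
    (forLoop 4 (cell 2)
      (.seq (.op (.vertexSubset (lit 6) (lit x) (bitCell (cell 4))))
        (.assign (lit 5) (.add (cell 5) (.mul (cell 6) (.pow (.const 2) (cell 4)))))))

/-- Store the vertex whose label precedes the content of the number cell `9` in the vertex-set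
cell `5`. -/
def vertexProg : Prog :=
  .seq (.op (.vertexOp .union (lit 5) (lit 0) (lit 0)))
    (forLoop 4 (cell 2)
      (.ite (.mod (.div (.sub (cell 9) (.const 1)) (.pow (.const 2) (cell 4))) (.const 2))
        (.op (.vertexOp .inter (lit 5) (lit 5) (bitCell (cell 4))))
        (.op (.vertexOp .diff (lit 5) (lit 5) (bitCell (cell 4))))))

/-- Remove the vertices in the vertex-set cell `5` from the current candidate set. -/
def removeProg : Prog :=
  .seq (.op (.vertexOp .diff (lit 4) (lit 4) (lit 5)))
    (forEach 5 7 (.seq (labelProg 7) (.assign (entry 32 (cell 5)) (lit 0))))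

/-- The length of the labels of vertices. -/
noncomputable def labelSize (V : Type*) : ℕ := Nat.log 2 (Nat.card V) + 1

/-- The data that are fixed after the vertices have been labelled: the target set, the random
vertices outside the target set, the parameter, and the labels. -/
structure Inst (V : Type*) extends Env V where
  T : Set V
  N : Set V
  p : ℕ
  lab : V → ℕ
  lab_inj : Function.Injective lab
  lab_lt : ∀ v, lab v < Nat.card V
  B_eq : B = 16 + labelSize V

variable {V : Type*}

theorem Inst.lab_lt_two_pow (D : Inst V) (v : V) : D.lab v < 2 ^ labelSize V :=
  (D.lab_lt v).trans (Nat.lt_pow_succ_log_self one_lt_two _)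

/-- The invariant of the algorithm. The candidate set is `A`; the array of flags for the candidate
set describes `A'`; the vertices whose successors have not been read are those in `U`. -/
structure Inv (D : Inst V) (A A' U : Set V) (c : Conf V) : Prop where
  n0 : c.num 0 = D.p
  n1 : c.num 1 = Nat.card V
  n2 : c.num 2 = labelSize V
  v0 : c.vs 0 = Set.univ
  v2 : c.vs 2 = D.N
  v3 : c.vs 3 = D.T
  v4 : c.vs 4 = A
  v10 : c.vs 10 = U
  bits : ∀ b < labelSize V, ∀ v, v ∈ c.vs (16 + b) ↔ (D.lab v).testBit b
  alive : ∀ i, c.num (4 * i + 32) ≠ 0 ↔ ∃ v ∈ A', D.lab v = i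
  unread : ∀ v, c.num (4 * D.lab v + 33) ≠ 0 ↔ v ∈ U
  adj_sound : ∀ u w, c.num (4 * (D.lab u * Nat.card V + D.lab w) + 35) ≠ 0 → (u, w) ∈ D.E
  adj_complete : ∀ u w, u ∉ U → w ∈ A → (u, w) ∈ D.E →
    c.num (4 * (D.lab u * Nat.card V + D.lab w) + 35) ≠ 0

/-- The number cells on which the invariant depends. -/
def NumKept (i : ℕ) : Prop := i < 3 ∨ (32 ≤ i ∧ i % 4 ≠ 2)

/-- The vertex-set cells on which the invariant depends. -/
def SetKept (i : ℕ) : Prop := i = 0 ∨ i = 2 ∨ i = 3 ∨ i = 4 ∨ i = 10 ∨ 16 ≤ i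

/-- The frame rule: scratch cells, and the marks at addresses congruent to 2 modulo 4, may be
overwritten freely. -/
theorem Inv.congr {D : Inst V} {A A' U : Set V} {c c' : Conf V} (h : Inv D A A' U c)
    (hn : ∀ i, NumKept i → c'.num i = c.num i) (hv : ∀ i, SetKept i → c'.vs i = c.vs i) :
    Inv D A A' U c' where
  n0 := by rw [hn 0 (by unfold NumKept; omega), h.n0]
  n1 := by rw [hn 1 (by unfold NumKept; omega), h.n1]
  n2 := by rw [hn 2 (by unfold NumKept; omega), h.n2]
  v0 := by rw [hv 0 (by unfold SetKept; omega), h.v0]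
  v2 := by rw [hv 2 (by unfold SetKept; omega), h.v2]
  v3 := by rw [hv 3 (by unfold SetKept; omega), h.v3]
  v4 := by rw [hv 4 (by unfold SetKept; omega), h.v4]
  v10 := by rw [hv 10 (by unfold SetKept; omega), h.v10]
  bits b hb v := by rw [hv (16 + b) (by unfold SetKept; omega), h.bits b hb]
  alive i := by rw [hn _ (by unfold NumKept; omega), h.alive]
  unread v := by rw [hn _ (by unfold NumKept; omega), h.unread]
  adj_sound u w := by rw [hn _ (by unfold NumKept; omega)]; exact h.adj_sound u w
  adj_complete u w := by rw [hn _ (by unfold NumKept; omega)]; exact h.adj_complete u w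

/-- Recorded edges remain complete because completeness is only demanded for targets in the
candidate set. The flags still describe `A'`; they are cleared one vertex at a time afterwards. -/
theorem Inv.restrict {D : Inst V} {A A' A₁ U : Set V} {c c' : Conf V} (h : Inv D A A' U c)
    (hA : A₁ ⊆ A) (h4 : c'.vs 4 = A₁) (hn : ∀ i, NumKept i → c'.num i = c.num i)
    (hv : ∀ i, SetKept i → i ≠ 4 → c'.vs i = c.vs i) : Inv D A₁ A' U c' where
  n0 := by rw [hn 0 (by unfold NumKept; omega), h.n0]
  n1 := by rw [hn 1 (by unfold NumKept; omega), h.n1]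
  n2 := by rw [hn 2 (by unfold NumKept; omega), h.n2]
  v0 := by rw [hv 0 (by unfold SetKept; omega) (by omega), h.v0]
  v2 := by rw [hv 2 (by unfold SetKept; omega) (by omega), h.v2]
  v3 := by rw [hv 3 (by unfold SetKept; omega) (by omega), h.v3]
  v4 := h4
  v10 := by rw [hv 10 (by unfold SetKept; omega) (by omega), h.v10]
  bits b hb v := by rw [hv (16 + b) (by unfold SetKept; omega) (by omega), h.bits b hb]
  alive i := by rw [hn _ (by unfold NumKept; omega), h.alive]
  unread v := by rw [hn _ (by unfold NumKept; omega), h.unread]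
  adj_sound u w := by rw [hn _ (by unfold NumKept; omega)]; exact h.adj_sound u w
  adj_complete u w hu hw := by
    rw [hn _ (by unfold NumKept; omega)]; exact h.adj_complete u w hu (hA hw)

/-- Labels are injective, so clearing one flag removes exactly one vertex. -/
theorem Inv.kill {D : Inst V} {A A' U : Set V} {v : V} {c c' : Conf V} (h : Inv D A A' U c)
    (h0 : c'.num (4 * D.lab v + 32) = 0)
    (hn : ∀ i, NumKept i → i ≠ 4 * D.lab v + 32 → c'.num i = c.num i)
    (hv : ∀ i, SetKept i → c'.vs i = c.vs i) : Inv D A (A' \ {v}) U c' where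
  n0 := by rw [hn 0 (by unfold NumKept; omega) (by omega), h.n0]
  n1 := by rw [hn 1 (by unfold NumKept; omega) (by omega), h.n1]
  n2 := by rw [hn 2 (by unfold NumKept; omega) (by omega), h.n2]
  v0 := by rw [hv 0 (by unfold SetKept; omega), h.v0]
  v2 := by rw [hv 2 (by unfold SetKept; omega), h.v2]
  v3 := by rw [hv 3 (by unfold SetKept; omega), h.v3]
  v4 := by rw [hv 4 (by unfold SetKept; omega), h.v4]
  v10 := by rw [hv 10 (by unfold SetKept; omega), h.v10]
  bits b hb v := by rw [hv (16 + b) (by unfold SetKept; omega), h.bits b hb]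
  alive i := by
    by_cases hi : i = D.lab v
    · subst hi
      refine iff_of_false (fun H => H h0) ?_
      rintro ⟨u, hu, he⟩
      exact hu.2 (D.lab_inj he)
    · rw [hn _ (by unfold NumKept; omega) (by omega), h.alive]
      refine exists_congr fun u => and_congr_left fun he => ⟨fun hu => ⟨hu, ?_⟩, fun hu => hu.1⟩
      rintro rfl
      exact hi he.symm
  unread v := by rw [hn _ (by unfold NumKept; omega) (by omega), h.unread]
  adj_sound u w := by rw [hn _ (by unfold NumKept; omega) (by omega)]; exact h.adj_sound u w
  adj_complete u w := by
    rw [hn _ (by unfold NumKept; omega) (by omega)]; exact h.adj_complete u w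

theorem mod_two_pow_succ (x k : ℕ) :
    x % 2 ^ (k + 1) = x % 2 ^ k + (if x.testBit k then 1 else 0) * 2 ^ k := by
  rw [Nat.mod_pow_succ, ← Nat.toNat_testBit, mul_comm]
  cases x.testBit k <;> rfl

theorem ncard_sdiff_singleton_add_one [Finite V] {Z : Set V} {v : V} (hv : v ∈ Z) :
    Z.ncard = (Z \ {v}).ncard + 1 :=
  (Set.ncard_sdiff_singleton_add_one hv (Set.toFinite _)).symm

variable {D : Inst V} {c : Conf V} {Q : Conf V → Prop} {A A' U : Set V}

/-- After `k` bit tests the accumulator is the label modulo `2 ^ k`, which is the full label once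
`k` is the label length. -/
theorem run_label {x : ℕ} {v : V} (hx : c.vs x = {v}) (h2 : c.num 2 = labelSize V)
    (bits : ∀ b < labelSize V, ∀ v, v ∈ c.vs (16 + b) ↔ (D.lab v).testBit b)
    (h : ∀ c' : Conf V, c'.vs = c.vs → c'.ops = c.ops + labelSize V → c'.num 5 = D.lab v →
      (∀ i, i ≠ 4 → i ≠ 5 → i ≠ 6 → c'.num i = c.num i) → Q c') :
    Run D.toEnv (labelProg x) c Q := by
  refine Run.seq (Run.assign ?_)
  refine Run.forLoop (N := labelSize V) (fun k c' => c'.vs = c.vs ∧ c'.ops = c.ops + k ∧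
    c'.num 5 = D.lab v % 2 ^ k ∧ ∀ i, i ≠ 4 → i ≠ 5 → i ≠ 6 → c'.num i = c.num i) ?_ ?_ ?_ ?_
  · rintro k c' ⟨-, -, -, hn⟩ -
    simp only [Expr.eval]
    rw [hn 2 (by omega) (by omega) (by omega), h2]
  · refine ⟨rfl, rfl, ?_, fun i h4 h5 _ => ?_⟩
    · simp [Expr.eval, Nat.mod_one]
    · simp [Expr.eval, Function.update_of_ne h4, Function.update_of_ne h5]
  · rintro k c' hk h4 ⟨hvs, hops, h5, hn⟩
    refine Run.seq (Run.vertexSubset (Run.assign ?_))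
    simp only [Expr.eval, hvs, hx, h4, Set.singleton_subset_iff, bits k hk]
    refine ⟨by simpa using h4, trivial, by rw [hops]; rfl, ?_, fun i i4 i5 i6 => ?_⟩
    · rw [mod_two_pow_succ]
      simp [h4, h5]
    · simp only [Function.update_of_ne i4, Function.update_of_ne i5, Function.update_of_ne i6]
      exact hn i i4 i5 i6
  · rintro c' ⟨hvs, hops, h5, hn⟩
    exact h c' hvs hops (by rw [h5, Nat.mod_eq_of_lt (D.lab_lt_two_pow v)]) hn

/-- After `k` steps the cell holds the vertices that agree with `d` in the lowest `k` bits of the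
label. The number cell holds the label plus one, since `0` is reserved for an unsuccessful search.
-/
theorem run_vertex {d : V} (h9 : c.num 9 = D.lab d + 1) (hI : Inv D A A' U c)
    (h : ∀ c' : Conf V, c'.vs 5 = {d} → (∀ i, i ≠ 5 → c'.vs i = c.vs i) →
      c'.ops = c.ops + labelSize V + 1 → (∀ i, i ≠ 4 → c'.num i = c.num i) → Q c') :
    Run D.toEnv vertexProg c Q := by
  have hB := D.B_eq
  refine Run.seq (Run.vertexOp (by simp only [Expr.eval]; omega) ?_)
  refine Run.forLoop (N := labelSize V) (fun k c' =>
    c'.vs 5 = {v | ∀ b < k, (D.lab v).testBit b = (D.lab d).testBit b} ∧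
    (∀ i, i ≠ 5 → c'.vs i = c.vs i) ∧ c'.ops = c.ops + k + 1 ∧
    ∀ i, i ≠ 4 → c'.num i = c.num i) ?_ ?_ ?_ ?_
  · rintro k c' ⟨-, -, -, hn⟩ -
    simp only [Expr.eval]
    rw [hn 2 (by omega), hI.n2]
  · refine ⟨?_, fun i hi => ?_, rfl, fun i hi => ?_⟩
    · simp [Expr.eval, SetOp.apply, hI.v0]
    · simp [Expr.eval, Function.update_of_ne hi]
    · simp [Function.update_of_ne hi]
  · rintro k c' hk h4 ⟨h5, hvs, hops, hn⟩
    have hbit : ∀ v, v ∈ c'.vs (16 + k) ↔ (D.lab v).testBit k := fun v => by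
      rw [hvs _ (by omega), hI.bits k hk]
    have h9' : c'.num 9 - 1 = D.lab d := by rw [hn 9 (by omega), h9]; rfl
    refine Run.ite (fun hb => ?_) (fun hb => ?_)
    · have hd : (D.lab d).testBit k = true := by
        simp only [Expr.eval, h9', h4] at hb
        rw [Nat.testBit_eq_decide_div_mod_eq]
        simp; omega
      refine Run.vertexOp (by simp only [Expr.eval]; omega) ?_
      simp only [Expr.eval, SetOp.apply, h4, h5]
      refine ⟨trivial, ?_, fun i hi => by simp [Function.update_of_ne hi, hvs i hi],
        by omega, fun i hi => by simp [Function.update_of_ne hi, hn i hi]⟩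
      ext v
      simp only [Function.update_self, Set.mem_inter_iff, Set.mem_ofPred_eq, hbit]
      refine ⟨fun H b hb => ?_, fun H => ⟨fun b hb => H b (by omega), by rw [H k (by omega), hd]⟩⟩
      rcases Nat.lt_succ_iff_lt_or_eq.1 hb with hb | rfl
      · exact H.1 b hb
      · rw [H.2, hd]
    · have hd : (D.lab d).testBit k = false := by
        simp only [Expr.eval, h9', h4] at hb
        rw [Nat.testBit_eq_decide_div_mod_eq]
        simp; omega
      refine Run.vertexOp (by simp only [Expr.eval]; omega) ?_
      simp only [Expr.eval, SetOp.apply, h4, h5]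
      refine ⟨trivial, ?_, fun i hi => by simp [Function.update_of_ne hi, hvs i hi],
        by omega, fun i hi => by simp [Function.update_of_ne hi, hn i hi]⟩
      ext v
      simp only [Function.update_self, Set.mem_sdiff, Set.mem_ofPred_eq, hbit, Bool.not_eq_true]
      refine ⟨fun H b hb => ?_, fun H => ⟨fun b hb => H b (by omega), by rw [H k (by omega), hd]⟩⟩
      rcases Nat.lt_succ_iff_lt_or_eq.1 hb with hb | rfl
      · exact H.1 b hb
      · rw [H.2, hd]
  · rintro c' ⟨h5, hvs, hops, hn⟩
    refine h c' ?_ hvs (by omega) hn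
    rw [h5]
    ext v
    simp only [Set.mem_ofPred_eq, Set.mem_singleton_iff]
    refine ⟨fun H => D.lab_inj (Nat.eq_of_testBit_eq fun b => ?_), fun H b _ => by rw [H]⟩
    by_cases hb : b < labelSize V
    · exact H b hb
    · have hp : 2 ^ labelSize V ≤ 2 ^ b := Nat.pow_le_pow_right two_pos (by omega)
      rw [Nat.testBit_lt_two_pow ((D.lab_lt_two_pow v).trans_le hp),
        Nat.testBit_lt_two_pow ((D.lab_lt_two_pow d).trans_le hp)]

theorem run_remove [Finite V] {X : Set V} (hI : Inv D A A U c) (h5 : c.vs 5 = X) (hX : X ⊆ A)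
    (h : ∀ c' : Conf V, Inv D (A \ X) (A \ X) U c' → c'.vs 5 = ∅ →
      c'.ops = c.ops + 2 + X.ncard * (labelSize V + 3) →
      (∀ i, 7 ≤ i → i < 32 → c'.num i = c.num i) → Q c') :
    Run D.toEnv removeProg c Q := by
  have hB := D.B_eq
  refine Run.seq (Run.vertexOp (by simp only [Expr.eval]; omega) ?_)
  simp only [Expr.eval, SetOp.apply, h5, hI.v4]
  -- The flags lag behind the set: they still describe `A \ X` together with the part `Z` not yet
  -- treated.
  refine Run.forEach (fun Z c' => Z ⊆ X ∧ Inv D (A \ X) ((A \ X) ∪ Z) U c' ∧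
    c'.ops + Z.ncard * (labelSize V + 3) = c.ops + 2 + X.ncard * (labelSize V + 3) ∧
    ∀ i, 7 ≤ i → i < 32 → c'.num i = c.num i) (by omega) (by omega) (by omega) ?_ ?_ ?_
  · simp only [Function.update_of_ne (show (5 : ℕ) ≠ 4 by decide), h5]
    refine ⟨subset_rfl, ?_, trivial, fun i hi _ => Function.update_of_ne (by omega) _ _⟩
    rw [Set.sdiff_union_of_subset hX]
    exact hI.restrict Set.sdiff_subset (by simp)
      (fun i hi => Function.update_of_ne (by unfold NumKept at hi; omega) _ _)
      (fun i _ hi => Function.update_of_ne hi _ _)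
  · rintro Z c' v hv hz ⟨hZ, hI', hops, hn⟩
    refine Run.seq (run_label (D := D) (v := v) ?_ ?_ ?_ ?_)
    · simp
    · exact hI'.n2
    · intro b hb u
      simp only [Function.update_of_ne (show 16 + b ≠ 5 by omega),
        Function.update_of_ne (show 16 + b ≠ 7 by omega)]
      exact hI'.bits b hb u
    · intro c₁ hvs hops₁ h5₁ hn₁
      refine Run.assign ?_
      simp only [Expr.eval, h5₁]
      refine ⟨by simp [hvs], Set.sdiff_subset.trans hZ, ?_, ?_, fun i hi hi' => ?_⟩
      · have : A \ X ∪ Z \ {v} = (A \ X ∪ Z) \ {v} := by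
          ext u
          simp only [Set.mem_union, Set.mem_sdiff, Set.mem_singleton_iff]
          refine ⟨?_, fun H => H.1.imp_right fun H' => ⟨H', H.2⟩⟩
          rintro (H | H)
          · exact ⟨Or.inl H, fun he => H.2 (he ▸ hZ hv)⟩
          · exact ⟨Or.inr H.1, H.2⟩
        rw [this]
        refine hI'.kill ?_ (fun i hi hne => ?_) fun i hi => ?_
        · simp
        · unfold NumKept at hi
          simp only [Function.update_of_ne hne, Function.update_of_ne (show i ≠ 6 by omega)]
          exact hn₁ i (by omega) (by omega) (by omega)
        · unfold SetKept at hi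
          simp only [hvs, Function.update_of_ne (show i ≠ 5 by omega),
            Function.update_of_ne (show i ≠ 7 by omega)]
      · rw [ncard_sdiff_singleton_add_one hv, add_mul] at hops
        simp only at hops₁ ⊢
        omega
      · simp only [Function.update_of_ne (show i ≠ 6 by omega),
          Function.update_of_ne (show i ≠ 4 * D.lab v + 32 by omega)]
        rw [hn₁ i (by omega) (by omega) (by omega)]
        exact hn i hi hi'
  · rintro c' hz ⟨-, hI', hops, hn⟩
    exact h c' (by simpa using hI') hz (by simpa using hops) hn

end Symbolic

/-! ### Searching the recorded graph without symbolic operations. -/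

/-- Shortest paths are not longer than the number of vertices. -/
theorem Leads.exists_leadsIn_le {V : Type*} [Finite V] {E : Set (V × V)} {A B : Set V} {v : V}
    (h : Leads E A B v) : ∃ k ≤ Nat.card V, LeadsIn E A B k v := by
  let S : ℕ → Set V := fun r => {v | ∃ k ≤ r, LeadsIn E A B k v}
  have hmono : ∀ r, S r ⊆ S (r + 1) := fun r v ⟨k, hk, hv⟩ => ⟨k, by omega, hv⟩
  -- The balls around `B` grow by at least one vertex per radius until they are stable, and a stable
  -- ball contains everything that leads to `B`.
  have key : ∀ r, (∀ v, Leads E A B v → v ∈ S r) ∨ r ≤ (S r).ncard := by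
    intro r
    induction r with
    | zero => exact Or.inr (Nat.zero_le _)
    | succ r ih =>
      rcases ih with ih | ih
      · exact Or.inl fun v hv => hmono r (ih v hv)
      by_cases heq : S (r + 1) ⊆ S r
      · refine Or.inl fun v hv => hmono r ?_
        induction hv with
        | base hA hB => exact ⟨0, Nat.zero_le _, hA, hB⟩
        | step hA he _ ihw =>
          obtain ⟨k, hk, hw⟩ := ihw
          exact heq ⟨k + 1, by omega, hA, _, he, hw⟩
      · have := Set.ncard_lt_ncard (ssubset_of_subset_not_subset (hmono r) heq)
          (Set.toFinite _)
        exact Or.inr (by omega)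
  rcases key (Nat.card V) with hk | hk
  · exact hk v h
  · have hu : S (Nat.card V) = Set.univ :=
      Set.eq_of_subset_of_ncard_le (Set.subset_univ _) (by rwa [Set.ncard_univ]) (Set.toFinite _)
    exact (hu ▸ Set.mem_univ v : v ∈ S (Nat.card V))

namespace Symbolic

/-- Mark the candidates whose successors have not been read. -/
def markUnreadProg : Prog :=
  forLoop 7 (cell 1) (.assign (entry 34 (cell 7))
    (.mul (.load (entry 32 (cell 7))) (.load (entry 33 (cell 7)))))

/-- Mark the candidates which have a marked successor, for all recorded edges once. -/
def propagateProg : Prog :=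
  forLoop 8 (.mul (cell 1) (cell 1)) (.assign (entry 34 (.div (cell 8) (cell 1)))
    (.add (.load (entry 34 (.div (cell 8) (cell 1))))
      (.mul (.load (entry 32 (.div (cell 8) (cell 1))))
        (.mul (.load (entry 35 (cell 8))) (.load (entry 34 (.mod (cell 8) (cell 1))))))))

/-- Store the successor of the label of an unmarked candidate in the number cell `9`, or `0` if all
candidates are marked. -/
def findUnmarkedProg : Prog :=
  .seq (.assign (lit 9) (lit 0))
    (forLoop 7 (cell 1)
      -- Marks can be arbitrarily large numbers; truncated subtraction from `1` negates them.
      (.ite (.mul (.load (entry 32 (cell 7))) (.sub (lit 1) (.load (entry 34 (cell 7)))))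
        (.assign (lit 9) (.add (cell 7) (lit 1))) .skip))

/-- Search, in the recorded part of the graph, for a candidate from which no candidate with unread
successors can be reached. -/
def searchProg : Prog :=
  .seq markUnreadProg (.seq (forLoop 7 (cell 1) propagateProg) findUnmarkedProg)

variable {V : Type*} {D : Inst V} {c : Conf V} {Q : Conf V → Prop} {A A' U : Set V}

/-- Only the counters `7, 8, 9` and the marks differ. -/
structure SearchFrame (c c' : Conf V) : Prop where
  vs : c'.vs = c.vs
  ops : c'.ops = c.ops
  num : ∀ i, i ≠ 7 → i ≠ 8 → i ≠ 9 → (i < 32 ∨ i % 4 ≠ 2) → c'.num i = c.num i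

theorem SearchFrame.inv {c' : Conf V} (h : SearchFrame c c') (hI : Inv D A A' U c) :
    Inv D A A' U c' :=
  hI.congr (fun i hi => h.num i (by unfold NumKept at hi; omega) (by unfold NumKept at hi; omega)
    (by unfold NumKept at hi; omega) (by unfold NumKept at hi; omega)) fun i _ => by rw [h.vs]

theorem SearchFrame.update {c' : Conf V} (h : SearchFrame c c') {j k : ℕ}
    (hj : j = 7 ∨ j = 8 ∨ j = 9 ∨ (32 ≤ j ∧ j % 4 = 2)) :
    SearchFrame c { c' with num := Function.update c'.num j k } :=
  ⟨h.vs, h.ops, fun i h7 h8 h9 hi => by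
    simp only [Function.update_of_ne (show i ≠ j by omega)]
    exact h.num i h7 h8 h9 hi⟩

theorem run_markUnread (hI : Inv D A A U c)
    (h : ∀ c' : Conf V, SearchFrame c c' → (∀ i < Nat.card V,
      (c'.num (4 * i + 34) ≠ 0 ↔ ∃ v ∈ A, v ∈ U ∧ D.lab v = i)) → Q c') :
    Run D.toEnv markUnreadProg c Q := by
  refine Run.forLoop (N := Nat.card V) (fun k c' => SearchFrame c c' ∧ ∀ i < k,
    (c'.num (4 * i + 34) ≠ 0 ↔ ∃ v ∈ A, v ∈ U ∧ D.lab v = i)) ?_ ?_ ?_ ?_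
  · rintro k c' ⟨hf, -⟩ -
    exact (hf.inv hI).n1
  · exact ⟨SearchFrame.update ⟨rfl, rfl, fun _ _ _ _ _ => rfl⟩ (by omega), fun i hi => by omega⟩
  · rintro k c' hk h7 ⟨hf, hm⟩
    refine Run.assign ?_
    simp only [Expr.eval, h7]
    refine ⟨by rw [Function.update_of_ne (by omega), h7],
      (hf.update (by omega)).update (by omega), fun i hi => ?_⟩
    rw [Function.update_of_ne (by omega)]
    by_cases hik : i = k
    · subst hik
      rw [Function.update_self, mul_ne_zero_iff, (hf.inv hI).alive]
      constructor
      · rintro ⟨⟨v, hv, rfl⟩, hu⟩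
        exact ⟨v, hv, ((hf.inv hI).unread v).1 hu, rfl⟩
      · rintro ⟨v, hv, hu, rfl⟩
        exact ⟨⟨v, hv, rfl⟩, ((hf.inv hI).unread v).2 hu⟩
    · rw [Function.update_of_ne (by omega)]
      exact hm i (by omega)
  · rintro c' ⟨hf, hm⟩
    exact h c' hf hm

/-- The marks are sound, and they contain the vertices at distance at most `r`. -/
structure Marks (D : Inst V) (A U : Set V) (r : ℕ) (c : Conf V) : Prop where
  sound : ∀ i < Nat.card V, c.num (4 * i + 34) ≠ 0 → ∃ v, D.lab v = i ∧ Leads D.E A U v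
  complete : ∀ v, ∀ k ≤ r, LeadsIn D.E A U k v → c.num (4 * D.lab v + 34) ≠ 0

/-- Marks are updated in place, so a pass may mark vertices farther away than `r + 1`. This is
harmless: soundness only asks for some path, and completeness only bounds the marks from below. -/
theorem run_propagate {r : ℕ} (hI : Inv D A A U c) (hm : Marks D A U r c)
    (h : ∀ c' : Conf V, SearchFrame c c' → c'.num 7 = c.num 7 → Marks D A U (r + 1) c' → Q c') :
    Run D.toEnv propagateProg c Q := by
  refine Run.forLoop (N := Nat.card V * Nat.card V) (fun q c' => SearchFrame c c' ∧
    c'.num 7 = c.num 7 ∧ Marks D A U r c' ∧ ∀ u w, D.lab u * Nat.card V + D.lab w < q → u ∈ A →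
      (u, w) ∈ D.E → (∃ k ≤ r, LeadsIn D.E A U k w) → c'.num (4 * D.lab u + 34) ≠ 0) ?_ ?_ ?_ ?_
  · rintro k c' ⟨hf, -⟩ -
    simp only [Expr.eval, (hf.inv hI).n1]
  · refine ⟨SearchFrame.update ⟨rfl, rfl, fun _ _ _ _ _ => rfl⟩ (by omega), by simp,
      ⟨fun i hi => ?_, fun v k hk => ?_⟩, fun u w hq => by omega⟩
    · simp only [Function.update_of_ne (show 4 * i + 34 ≠ 8 by omega)]
      exact hm.sound i hi
    · simp only [Function.update_of_ne (show 4 * D.lab v + 34 ≠ 8 by omega)]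
      exact hm.complete v k hk
  · rintro q c' hq h8 ⟨hf, h7, hm', hp⟩
    have hI' := hf.inv hI
    have hpos : 0 < Nat.card V := Nat.pos_of_ne_zero fun h0 => by simp [h0] at hq
    refine Run.assign ?_
    simp only [Expr.eval, h8, hI'.n1]
    -- For natural numbers tested against zero, a sum is a disjunction and a product a conjunction.
    have hval : ∀ i, Function.update (Function.update c'.num (4 * (q / Nat.card V) + 34)
        (c'.num (4 * (q / Nat.card V) + 34) + c'.num (4 * (q / Nat.card V) + 32) *
          (c'.num (4 * q + 35) * c'.num (4 * (q % Nat.card V) + 34)))) 8 (q + 1) (4 * i + 34) ≠ 0 ↔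
        c'.num (4 * i + 34) ≠ 0 ∨ (i = q / Nat.card V ∧ c'.num (4 * i + 32) ≠ 0 ∧
          c'.num (4 * q + 35) ≠ 0 ∧ c'.num (4 * (q % Nat.card V) + 34) ≠ 0) := by
      intro i
      rw [Function.update_of_ne (by omega)]
      by_cases hi : i = q / Nat.card V
      · subst hi
        rw [Function.update_self]
        simp only [true_and, ← mul_ne_zero_iff]
        omega
      · rw [Function.update_of_ne (by omega)]
        simp [hi]
    refine ⟨by rw [Function.update_of_ne (by omega), h8],
      (hf.update (by omega)).update (by omega), ?_, ⟨fun i hi => ?_, fun v k hk hv => ?_⟩,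
      fun u w hlt hu he hw => ?_⟩
    · rw [Function.update_of_ne (by omega), Function.update_of_ne (by omega), h7]
    · simp only [hval]
      rintro (H | ⟨rfl, ha, hadj, hr⟩)
      · exact hm'.sound i hi H
      · obtain ⟨u, hu, hlab⟩ := (hI'.alive _).1 ha
        obtain ⟨w, hlabw, hw⟩ := hm'.sound _ (Nat.mod_lt _ hpos) hr
        refine ⟨u, hlab, .step hu (hI'.adj_sound u w ?_) hw⟩
        rw [hlab, hlabw, Nat.div_add_mod']
        exact hadj
    · simp only [hval]
      exact Or.inl (hm'.complete v k hk hv)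
    · simp only [hval]
      rcases Nat.lt_succ_iff_lt_or_eq.1 hlt with hlt | heq
      · exact Or.inl (hp u w hlt hu he hw)
      obtain ⟨k, hk, hkw⟩ := hw
      -- An unread vertex is marked from the start, at distance zero; for a read one the edge is on
      -- record.
      by_cases hU : u ∈ U
      · exact Or.inl (hm'.complete u 0 (Nat.zero_le _) ⟨hu, hU⟩)
      · have hdiv : q / Nat.card V = D.lab u := by
          rw [← heq, mul_comm, Nat.mul_add_div hpos, Nat.div_eq_of_lt (D.lab_lt w), add_zero]
        have hmod : q % Nat.card V = D.lab w := by
          rw [← heq, mul_comm, Nat.mul_add_mod, Nat.mod_eq_of_lt (D.lab_lt w)]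
        refine Or.inr ⟨hdiv.symm, (hI'.alive _).2 ⟨u, hu, rfl⟩, ?_, ?_⟩
        · rw [← heq]
          exact hI'.adj_complete u w hU hkw.mem he
        · rw [hmod]
          exact hm'.complete w k hk hkw
  · rintro c' ⟨hf, h7, hm', hp⟩
    refine h c' hf h7 ⟨hm'.sound, fun v k hk hv => ?_⟩
    cases k with
    | zero => exact hm'.complete v 0 (Nat.zero_le _) hv
    | succ k =>
      obtain ⟨hA, w, he, hw⟩ := hv
      refine hp v w ?_ hA he ⟨k, by omega, hw⟩
      calc D.lab v * Nat.card V + D.lab w < D.lab v * Nat.card V + Nat.card V :=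
            Nat.add_lt_add_left (D.lab_lt w) _
        _ = (D.lab v + 1) * Nat.card V := by ring
        _ ≤ Nat.card V * Nat.card V := Nat.mul_le_mul_right _ (D.lab_lt v)

theorem SearchFrame.trans {c₁ c₂ : Conf V} (h : SearchFrame c c₁) (h' : SearchFrame c₁ c₂) :
    SearchFrame c c₂ :=
  ⟨h'.vs.trans h.vs, h'.ops.trans h.ops, fun i h7 h8 h9 hi =>
    (h'.num i h7 h8 h9 hi).trans (h.num i h7 h8 h9 hi)⟩

theorem run_findUnmarked (hI : Inv D A A U c)
    (hm : ∀ v, c.num (4 * D.lab v + 34) ≠ 0 ↔ Leads D.E A U v)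
    (h : ∀ c' : Conf V, SearchFrame c c' → (c'.num 9 = 0 ∧ ∀ v ∈ A, Leads D.E A U v) ∨
      (∃ d ∈ A, c'.num 9 = D.lab d + 1 ∧ ¬ Leads D.E A U d) → Q c') :
    Run D.toEnv findUnmarkedProg c Q := by
  refine Run.seq (Run.assign ?_)
  refine Run.forLoop (N := Nat.card V) (fun k c' => SearchFrame c c' ∧
    (∀ v, c'.num (4 * D.lab v + 34) ≠ 0 ↔ Leads D.E A U v) ∧
    ((c'.num 9 = 0 ∧ ∀ v ∈ A, D.lab v < k → Leads D.E A U v) ∨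
      (∃ d ∈ A, c'.num 9 = D.lab d + 1 ∧ ¬ Leads D.E A U d))) ?_ ?_ ?_ ?_
  · rintro k c' ⟨hf, -⟩ -
    simp only [Expr.eval, (hf.inv hI).n1]
  · refine ⟨SearchFrame.update (SearchFrame.update ⟨rfl, rfl, fun _ _ _ _ _ => rfl⟩
      (by simp [Expr.eval])) (by omega), fun v => ?_,
      Or.inl ⟨by simp [Expr.eval], fun v _ hv => by omega⟩⟩
    simp only [Expr.eval]
    rw [Function.update_of_ne (by omega), Function.update_of_ne (by omega)]
    exact hm v
  · rintro k c' hk h7 ⟨hf, hm', hd⟩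
    have hI' := hf.inv hI
    refine Run.ite (fun hb => Run.assign ?_) (fun hb => Run.skip ?_)
    · simp only [Expr.eval, h7, mul_ne_zero_iff] at hb ⊢
      obtain ⟨u, hu, rfl⟩ := (hI'.alive _).1 hb.1
      refine ⟨by simp [h7], (hf.update (by omega)).update (by omega), fun v => ?_,
        Or.inr ⟨u, hu, by simp, fun hl => ?_⟩⟩
      · rw [Function.update_of_ne (by omega), Function.update_of_ne (by omega)]
        exact hm' v
      · have := (hm' u).2 hl
        omega
    · simp only [Expr.eval, h7] at hb ⊢
      refine ⟨trivial, hf.update (by omega), fun v => ?_, ?_⟩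
      · rw [Function.update_of_ne (by omega)]
        exact hm' v
      · rw [Function.update_of_ne (by omega)]
        refine hd.imp (fun H => ⟨H.1, fun v hv hlt => ?_⟩) id
        rcases Nat.lt_succ_iff_lt_or_eq.1 hlt with hlt | rfl
        · exact H.2 v hv hlt
        · refine (hm' v).1 fun h0 => ?_
          rw [h0] at hb
          exact (hI'.alive _).2 ⟨v, hv, rfl⟩ (by simpa using hb)
  · rintro c' ⟨hf, -, hd⟩
    exact h c' hf (hd.imp (fun H => ⟨H.1, fun v hv => H.2 v hv (D.lab_lt v)⟩) id)

/-- As many passes as there are vertices cover all distances. The record is incomplete only at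
vertices of `U`, which are the goals of the search, so it decides reachability of `U` in the true
graph on `A`. Number operations are free, hence `SearchFrame` keeps the operation count. -/
theorem run_search [Finite V] (hI : Inv D A A U c)
    (h : ∀ c' : Conf V, SearchFrame c c' → (c'.num 9 = 0 ∧ ∀ v ∈ A, Leads D.E A U v) ∨
      (∃ d ∈ A, c'.num 9 = D.lab d + 1 ∧ ¬ Leads D.E A U d) → Q c') :
    Run D.toEnv searchProg c Q := by
  refine Run.seq (run_markUnread hI fun c₁ hf₁ hm₁ => Run.seq ?_)
  refine Run.forLoop (N := Nat.card V)
    (fun r c' => SearchFrame c c' ∧ Marks D A U r c') ?_ ?_ ?_ ?_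
  · rintro k c' ⟨hf, -⟩ -
    simp only [Expr.eval, (hf.inv hI).n1]
  · refine ⟨hf₁.update (by omega), fun i hi => ?_, fun v k hk hv => ?_⟩
    · simp only [Function.update_of_ne (show 4 * i + 34 ≠ 7 by omega)]
      rw [hm₁ i hi]
      rintro ⟨v, hv, hu, rfl⟩
      exact ⟨v, rfl, .base hv hu⟩
    · simp only [Function.update_of_ne (show 4 * D.lab v + 34 ≠ 7 by omega)]
      obtain rfl : k = 0 := by omega
      exact (hm₁ _ (D.lab_lt v)).2 ⟨v, hv.1, hv.2, rfl⟩
  · rintro r c' hr h7 ⟨hf, hm⟩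
    refine run_propagate (hf.inv hI) hm fun c₂ hf₂ h7₂ hm₂ => ⟨h7₂.trans h7,
      (hf.trans hf₂).update (by omega), fun i hi => ?_, fun v k hk hv => ?_⟩
    · simp only [Function.update_of_ne (show 4 * i + 34 ≠ 7 by omega)]
      exact hm₂.sound i hi
    · simp only [Function.update_of_ne (show 4 * D.lab v + 34 ≠ 7 by omega)]
      exact hm₂.complete v k hk hv
  · rintro c' ⟨hf, hm⟩
    refine run_findUnmarked (hf.inv hI) (fun v => ⟨fun hv => ?_, fun hv => ?_⟩)
      fun c₂ hf₂ => h c₂ (hf.trans hf₂)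
    · obtain ⟨u, hu, hl⟩ := hm.sound _ (D.lab_lt v) hv
      exact D.lab_inj hu ▸ hl
    · obtain ⟨k, hk, hkv⟩ := hv.exists_leadsIn_le
      exact hm.complete v k hk hkv

end Symbolic

/-! ### Reading the successors of vertices of small degree. -/

namespace Symbolic

/-- Record the successors, in the vertex-set cell `8`, of the vertex in the vertex-set
cell `11`. -/
def readProg : Prog :=
  .seq (labelProg 11)
    (.seq (.assign (lit 12) (cell 5))
      (.seq (forEach 8 7 (.seq (labelProg 7)
          (.assign (entry 35 (.add (.mul (cell 12) (cell 1)) (cell 5))) (lit 1))))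
        (.seq (.assign (entry 33 (cell 12)) (lit 0))
          (.op (.vertexOp .diff (lit 10) (lit 10) (lit 11))))))

/-- Read the successors of all candidates outside the target set with few successors. -/
def scanProg : Prog :=
  .seq (.op (.vertexOp .inter (lit 6) (lit 4) (lit 10)))
    (.seq (.op (.vertexOp .diff (lit 6) (lit 6) (lit 3)))
      (forEach 6 11
        (.seq (.op (.post (lit 8) (lit 0) (lit 11)))
          (.seq (.op (.vertexOp .inter (lit 8) (lit 8) (lit 4)))
            (.seq (.op (.card (lit 6) (lit 8)))
              -- The truncated difference is non-zero exactly when there are at most `p` successors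
              -- among the candidates.
              (.ite (.sub (.add (cell 0) (.const 1)) (cell 6)) readProg .skip))))))

/-- Remove candidates that are not almost-sure winning, as long as this is possible on the basis of
one symbolic predecessor operation or the recorded edges. -/
def pruneProg : Prog :=
  .seq (.assign (lit 11) (.const 1))
    (.loop (cell 11)
      (.seq (.op (.vertexOp .diff (lit 5) (lit 0) (lit 4)))
        (.seq (.op (.pre (lit 5) (lit 0) (lit 5)))
          (.seq (.op (.vertexOp .inter (lit 5) (lit 5) (lit 2)))
            (.seq (.op (.vertexOp .inter (lit 5) (lit 5) (lit 4)))
              (.seq (.op (.card (lit 11) (lit 5)))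
                (.seq
                  (.ite (cell 11) .skip
                    (.seq searchProg
                      (.ite (cell 9) (.seq vertexProg (.assign (lit 11) (.const 1))) .skip)))
                  removeProg)))))))

/-- Remove the candidates from which the target set cannot be reached; their number is stored in
the number cell `10`. -/
def reachProg : Prog :=
  .seq (.op (.vertexOp .union (lit 8) (lit 3) (lit 3)))
    (.seq (.assign (lit 13) (.const 1))
      (.seq
        (.loop (cell 13)
          (.seq (.op (.pre (lit 9) (lit 0) (lit 8)))
            (.seq (.op (.vertexOp .inter (lit 9) (lit 9) (lit 4)))
              (.seq (.op (.vertexOp .diff (lit 9) (lit 9) (lit 8)))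
                (.seq (.op (.vertexOp .union (lit 8) (lit 8) (lit 9)))
                  (.op (.card (lit 13) (lit 9))))))))
        (.seq (.op (.vertexOp .diff (lit 5) (lit 4) (lit 8)))
          (.seq (.op (.card (lit 10) (lit 5))) removeProg))))

variable {V : Type*} {D : Inst V} {c : Conf V} {Q : Conf V → Prop} {A A' U : Set V}

/-- The successors of `v` in the set `A`. -/
def succIn (E : Set (V × V)) (A : Set V) (v : V) : Set V := {w | (v, w) ∈ E} ∩ A

/-- The vertex `u` may still count as unread here: setting one sound entry never violates
completeness, so edges can be entered one by one. -/
theorem Inv.record {u w : V} {c' : Conf V} (h : Inv D A A' U c) (hE : (u, w) ∈ D.E)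
    (h1 : c'.num (4 * (D.lab u * Nat.card V + D.lab w) + 35) = 1)
    (hn : ∀ i, NumKept i → i ≠ 4 * (D.lab u * Nat.card V + D.lab w) + 35 → c'.num i = c.num i)
    (hv : ∀ i, SetKept i → c'.vs i = c.vs i) : Inv D A A' U c' where
  n0 := by rw [hn 0 (by unfold NumKept; omega) (by omega), h.n0]
  n1 := by rw [hn 1 (by unfold NumKept; omega) (by omega), h.n1]
  n2 := by rw [hn 2 (by unfold NumKept; omega) (by omega), h.n2]
  v0 := by rw [hv 0 (by unfold SetKept; omega), h.v0]
  v2 := by rw [hv 2 (by unfold SetKept; omega), h.v2]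
  v3 := by rw [hv 3 (by unfold SetKept; omega), h.v3]
  v4 := by rw [hv 4 (by unfold SetKept; omega), h.v4]
  v10 := by rw [hv 10 (by unfold SetKept; omega), h.v10]
  bits b hb v := by rw [hv (16 + b) (by unfold SetKept; omega), h.bits b hb]
  alive i := by rw [hn _ (by unfold NumKept; omega) (by omega), h.alive]
  unread v := by rw [hn _ (by unfold NumKept; omega) (by omega), h.unread]
  adj_sound x y := by
    by_cases he : D.lab x * Nat.card V + D.lab y = D.lab u * Nat.card V + D.lab w
    · have hpos : 0 < Nat.card V := (Nat.zero_le _).trans_lt (D.lab_lt u)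
      have hx : D.lab x = D.lab u := by
        have := congrArg (· / Nat.card V) he
        simpa only [mul_comm _ (Nat.card V), Nat.mul_add_div hpos, Nat.div_eq_of_lt (D.lab_lt _),
          add_zero] using this
      have hy : D.lab y = D.lab w := by rw [hx] at he; omega
      rw [D.lab_inj hx, D.lab_inj hy]
      exact fun _ => hE
    · rw [hn _ (by unfold NumKept; omega) (by omega)]
      exact h.adj_sound x y
  adj_complete x y hx hy hxy := by
    by_cases he : D.lab x * Nat.card V + D.lab y = D.lab u * Nat.card V + D.lab w
    · rw [he, h1]; exact one_ne_zero
    · rw [hn _ (by unfold NumKept; omega) (by omega)]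
      exact h.adj_complete x y hx hy hxy

/-- Leaving `U` is what activates the completeness clause for `u`, hence the demand that all its
edges into `A` be on record. -/
theorem Inv.read {u : V} {c' : Conf V} (h : Inv D A A' U c)
    (hE : ∀ w ∈ succIn D.E A u, c.num (4 * (D.lab u * Nat.card V + D.lab w) + 35) ≠ 0)
    (h0 : c'.num (4 * D.lab u + 33) = 0) (h10 : c'.vs 10 = U \ {u})
    (hn : ∀ i, NumKept i → i ≠ 4 * D.lab u + 33 → c'.num i = c.num i)
    (hv : ∀ i, SetKept i → i ≠ 10 → c'.vs i = c.vs i) : Inv D A A' (U \ {u}) c' where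
  n0 := by rw [hn 0 (by unfold NumKept; omega) (by omega), h.n0]
  n1 := by rw [hn 1 (by unfold NumKept; omega) (by omega), h.n1]
  n2 := by rw [hn 2 (by unfold NumKept; omega) (by omega), h.n2]
  v0 := by rw [hv 0 (by unfold SetKept; omega) (by omega), h.v0]
  v2 := by rw [hv 2 (by unfold SetKept; omega) (by omega), h.v2]
  v3 := by rw [hv 3 (by unfold SetKept; omega) (by omega), h.v3]
  v4 := by rw [hv 4 (by unfold SetKept; omega) (by omega), h.v4]
  v10 := h10
  bits b hb v := by rw [hv (16 + b) (by unfold SetKept; omega) (by omega), h.bits b hb]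
  alive i := by rw [hn _ (by unfold NumKept; omega) (by omega), h.alive]
  unread v := by
    by_cases hvu : v = u
    · subst hvu
      exact iff_of_false (fun H => H h0) fun H => H.2 rfl
    · rw [hn _ (by unfold NumKept; omega) fun he => hvu (D.lab_inj (by omega)), h.unread]
      exact ⟨fun H => ⟨H, hvu⟩, fun H => H.1⟩
  adj_sound x y := by
    rw [hn _ (by unfold NumKept; omega) (by omega)]; exact h.adj_sound x y
  adj_complete x y hx hy hxy := by
    rw [hn _ (by unfold NumKept; omega) (by omega)]
    by_cases hxu : x = u
    · subst hxu
      exact hE y ⟨hxy, hy⟩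
    · exact h.adj_complete x y (fun H => hx ⟨H, hxu⟩) hy hxy

theorem run_read [Finite V] {u : V} (hI : Inv D A A U c) (h11 : c.vs 11 = {u})
    (h8 : c.vs 8 = succIn D.E A u)
    (h : ∀ c' : Conf V, Inv D A A (U \ {u}) c' → c'.vs 6 = c.vs 6 →
      c'.ops = c.ops + labelSize V + 2 + (succIn D.E A u).ncard * (labelSize V + 3) → Q c') :
    Run D.toEnv readProg c Q := by
  have hB := D.B_eq
  refine Run.seq (run_label h11 hI.n2 hI.bits fun c₁ hvs₁ hops₁ h5₁ hn₁ => ?_)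
  refine Run.seq (Run.assign ?_)
  simp only [Expr.eval, h5₁]
  refine Run.seq (Run.forEach (fun Z c' => Inv D A A U c' ∧ c'.vs 6 = c.vs 6 ∧ c'.vs 11 = {u} ∧
    c'.num 12 = D.lab u ∧ Z ⊆ succIn D.E A u ∧
    c'.ops + Z.ncard * (labelSize V + 3) =
      c.ops + labelSize V + 1 + (succIn D.E A u).ncard * (labelSize V + 3) ∧
    ∀ w ∈ succIn D.E A u, w ∉ Z → c'.num (4 * (D.lab u * Nat.card V + D.lab w) + 35) ≠ 0)
    (by omega) (by omega) (by omega) ?_ ?_ ?_)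
  · simp only [hvs₁, h8]
    refine ⟨hI.congr (fun i hi => ?_) fun i _ => rfl, trivial, h11, by simp, subset_rfl,
      by omega, fun w hw hw' => absurd hw hw'⟩
    unfold NumKept at hi
    simp only [Function.update_of_ne (show i ≠ 6 by omega),
      Function.update_of_ne (show i ≠ 12 by omega)]
    exact hn₁ i (by omega) (by omega) (by omega)
  · rintro Z c' w hw hz ⟨hI', h6, h11', h12, hZ, hops, hadj⟩
    refine Run.seq (run_label (D := D) (v := w) (by simp) hI'.n2 (fun b hb v => ?_) ?_)
    · simp only [Function.update_of_ne (show 16 + b ≠ 8 by omega),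
        Function.update_of_ne (show 16 + b ≠ 7 by omega)]
      exact hI'.bits b hb v
    intro c₂ hvs₂ hops₂ h5₂ hn₂
    refine Run.assign ?_
    have h12₂ : c₂.num 12 = D.lab u := (hn₂ 12 (by omega) (by omega) (by omega)).trans h12
    have h1₂ : c₂.num 1 = Nat.card V := (hn₂ 1 (by omega) (by omega) (by omega)).trans hI'.n1
    simp only [Expr.eval, h12₂, h1₂, h5₂]
    refine ⟨by simp [hvs₂], ?_, by simp [hvs₂, h6], by simp [hvs₂, h11'], ?_,
      Set.sdiff_subset.trans hZ, ?_, ?_⟩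
    · refine hI'.record (u := u) (w := w) (hZ hw).1 ?_ (fun i hi hne => ?_) fun i hi => ?_
      · simp
      · unfold NumKept at hi
        simp only [Function.update_of_ne hne, Function.update_of_ne (show i ≠ 6 by omega)]
        exact hn₂ i (by omega) (by omega) (by omega)
      · unfold SetKept at hi
        simp only [hvs₂, Function.update_of_ne (show i ≠ 8 by omega),
          Function.update_of_ne (show i ≠ 7 by omega)]
    · rw [Function.update_of_ne (by omega), Function.update_of_ne (by omega), h12₂]
    · rw [ncard_sdiff_singleton_add_one hw, add_mul] at hops
      simp only at hops₂ ⊢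
      omega
    · intro x hx hxZ
      rw [Function.update_of_ne (by omega)]
      by_cases hxw : x = w
      · subst hxw
        simp
      · rw [Function.update_of_ne]
        · rw [hn₂ _ (by omega) (by omega) (by omega)]
          exact hadj x hx fun hxz => hxZ ⟨hxz, hxw⟩
        · exact fun he => hxw (D.lab_inj (by omega))
  · rintro c' hz ⟨hI', h6, h11', h12, -, hops, hadj⟩
    refine Run.seq (Run.assign (Run.vertexOp (by simp only [Expr.eval]; omega) ?_))
    simp only [Expr.eval, SetOp.apply, h12, h11', hI'.v10]
    refine h _ (hI'.read (fun w hw => hadj w hw (Set.notMem_empty w)) (by simp) (by simp)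
      (fun i _ hi => by simp [Function.update_of_ne hi])
      fun i _ hi => by simp [Function.update_of_ne hi]) (by simp [h6]) ?_
    simp only [Set.ncard_empty, zero_mul] at hops
    simp only
    omega

/-- The cost of reading the successors of a vertex. -/
noncomputable def readCost (D : Inst V) : ℕ := labelSize V + 2 + D.p * (labelSize V + 3)

/-- The number of unread vertices times `readCost` serves as a potential that pays for all reading,
so only three operations plus six per inspected vertex are charged to the round. Target vertices are
never read, which keeps `T` inside `U`. -/
theorem run_scan [Finite V] (hI : Inv D A A U c) (hTU : D.T ⊆ U)
    (h : ∀ (c' : Conf V) (U' : Set V), Inv D A A U' c' → D.T ⊆ U' →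
      (∀ v ∈ A, v ∈ U' → v ∉ D.T → D.p < (succIn D.E A v).ncard) →
      c'.ops + U'.ncard * readCost D ≤ c.ops + U.ncard * readCost D + 3 + 6 * Nat.card V → Q c') :
    Run D.toEnv scanProg c Q := by
  have hB := D.B_eq
  refine Run.seq (Run.vertexOp (by simp only [Expr.eval]; omega) ?_)
  refine Run.seq (Run.vertexOp (by simp only [Expr.eval]; omega) ?_)
  simp only [Expr.eval, SetOp.apply]
  refine Run.forEach (fun Z c' => ∃ U', Inv D A A U' c' ∧ D.T ⊆ U' ∧ Z ⊆ U' ∧ Z ∩ D.T = ∅ ∧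
    (∀ v ∈ A, v ∈ U' → v ∉ D.T → v ∉ Z → D.p < (succIn D.E A v).ncard) ∧
    c'.ops + U'.ncard * readCost D + 6 * Z.ncard ≤
      c.ops + U.ncard * readCost D + 3 + 6 * Nat.card V) (by omega) (by omega) (by omega) ?_ ?_ ?_
  · simp only [Function.update_self, Function.update_of_ne (show (3 : ℕ) ≠ 6 by omega),
      hI.v4, hI.v10, hI.v3]
    refine ⟨U, hI.congr (fun i hi => ?_) (fun i hi => ?_), hTU, fun v hv => hv.1.2, ?_,
      fun v hA hU hT hZ => absurd ⟨⟨hA, hU⟩, hT⟩ hZ, ?_⟩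
    · unfold NumKept at hi
      simp only [Function.update_of_ne (show i ≠ 6 by omega)]
    · unfold SetKept at hi
      simp only [Function.update_of_ne (show i ≠ 6 by omega)]
    · exact Set.sdiff_inter_self
    · have : ((A ∩ U) \ D.T).ncard ≤ Nat.card V := Set.ncard_le_card _
      omega
  · rintro Z c' v hv hz ⟨U', hI', hT', hZU, hZT, hdeg, hops⟩
    have hc := ncard_sdiff_singleton_add_one hv
    refine Run.seq (Run.post (by simp only [Expr.eval]; omega) ?_)
    refine Run.seq (Run.vertexOp (by simp only [Expr.eval]; omega) ?_)
    refine Run.seq (Run.card ?_)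
    have hs : {w | ∃ x ∈ ({v} : Set V), (x, w) ∈ D.E} ∩ A = succIn D.E A v := by
      simp [succIn]
    simp only [Expr.eval, SetOp.apply, Function.update_self,
      Function.update_of_ne (show (11 : ℕ) ≠ 6 by omega),
      Function.update_of_ne (show (4 : ℕ) ≠ 8 by omega),
      Function.update_of_ne (show (4 : ℕ) ≠ 6 by omega),
      Function.update_of_ne (show (4 : ℕ) ≠ 11 by omega), hI'.v4, hs]
    have hI₁ : Inv D A A U' ⟨Function.update c'.num 6 (succIn D.E A v).ncard,
        Function.update (Function.update (Function.update (Function.update c'.vs 11 {v}) 6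
          (Z \ {v})) 8 {w | ∃ x ∈ ({v} : Set V), (x, w) ∈ D.E}) 8 (succIn D.E A v),
        c'.ops + 2 + 1 + 1 + 1⟩ := by
      refine hI'.congr (fun i hi => ?_) fun i hi => ?_
      · unfold NumKept at hi
        simp only [Function.update_of_ne (show i ≠ 6 by omega)]
      · unfold SetKept at hi
        simp only [Function.update_of_ne (show i ≠ 6 by omega),
          Function.update_of_ne (show i ≠ 8 by omega), Function.update_of_ne (show i ≠ 11 by omega)]
    refine Run.ite (fun hb => ?_) fun hb => Run.skip ?_
    · simp only [Expr.eval, Function.update_self, Function.update_of_ne (show (0 : ℕ) ≠ 6 by omega),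
        hI'.n0] at hb
      refine run_read (u := v) hI₁ (by simp) (by simp) fun c₂ hI₂ h6₂ hops₂ =>
        ⟨by simpa using h6₂, U' \ {v}, ?_, ?_, ?_, ?_, ?_, ?_⟩
      · refine hI₂.congr (fun i hi => ?_) fun i hi => rfl
        unfold NumKept at hi
        simp only [Function.update_of_ne (show i ≠ 6 by omega)]
      · refine fun x hx => ⟨hT' hx, ?_⟩
        rintro rfl
        exact (Set.mem_empty_iff_false x).1 (hZT ▸ ⟨hv, hx⟩)
      · exact fun x hx => ⟨hZU hx.1, hx.2⟩
      · exact Set.subset_eq_empty (Set.inter_subset_inter_left _ Set.sdiff_subset) hZT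
      · exact fun x hA hU hT hZ => hdeg x hA hU.1 hT fun H => hZ ⟨H, hU.2⟩
      · have hU := ncard_sdiff_singleton_add_one (hZU hv)
        have hle : (succIn D.E A v).ncard * (labelSize V + 3) ≤ D.p * (labelSize V + 3) :=
          Nat.mul_le_mul_right _ (by omega)
        rw [hU, add_mul] at hops
        simp only at hops₂ ⊢
        have hr : readCost D = labelSize V + 2 + D.p * (labelSize V + 3) := rfl
        omega
    · simp only [Expr.eval, Function.update_self, Function.update_of_ne (show (0 : ℕ) ≠ 6 by omega),
        hI'.n0] at hb
      refine ⟨by simp, U', hI₁.congr (fun i hi => ?_) fun i hi => rfl, hT',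
        Set.sdiff_subset.trans hZU,
        Set.subset_eq_empty (Set.inter_subset_inter_left _ Set.sdiff_subset) hZT, ?_, ?_⟩
      · unfold NumKept at hi
        simp only [Function.update_of_ne (show i ≠ 6 by omega)]
      · intro x hA hU hT hZ
        by_cases hxv : x = v
        · subst hxv
          omega
        · exact hdeg x hA hU hT fun H => hZ ⟨H, hxv⟩
      · simp only
        omega
  · rintro c' - ⟨U', hI', hT', -, -, hdeg, hops⟩
    exact h c' U' hI' hT' (fun v hA hU hT => hdeg v hA hU hT (Set.notMem_empty v)) (by omega)

end Symbolic

/-! ### Deleting candidates: pruning and backward reachability. -/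

namespace Symbolic

variable {V : Type*} {D : Inst V} {c : Conf V} {Q : Conf V → Prop} {A A' U W : Set V}

/-- The properties of the almost-sure winning set that ensure that it is never left. -/
structure Winning (D : Inst V) (W : Set V) : Prop where
  target : D.T ⊆ W
  random : ∀ v ∈ W, v ∈ D.N → ∀ w, (v, w) ∈ D.E → w ∈ W
  leads : ∀ v ∈ W, Leads D.E W D.T v

/-- The cost of the removal of a candidate. -/
noncomputable def removeCost (V : Type*) : ℕ := 2 * labelSize V + 11

theorem ncard_sdiff_add [Finite V] {X A : Set V} (h : X ⊆ A) :
    (A \ X).ncard + X.ncard = A.ncard := Set.ncard_sdiff_add_ncard_of_subset h (Set.toFinite _)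

/-- The invariant of the loop of `pruneProg`, where `k` bounds the cost. -/
def PruneInv (D : Inst V) (A U W : Set V) (k : ℕ) (c : Conf V) : Prop :=
  ∃ A₁, Inv D A₁ A₁ U c ∧ W ⊆ A₁ ∧ A₁ ⊆ A ∧
    ((c.num 11 ≠ 0 ∧ c.ops + A₁.ncard * removeCost V ≤ k) ∨
     (c.num 11 = 0 ∧ (∀ v ∈ A₁, v ∈ D.N → ∀ w, (v, w) ∈ D.E → w ∈ A₁) ∧
      (∀ v ∈ A₁, Leads D.E A₁ U v) ∧ c.ops + A₁.ncard * removeCost V ≤ k + 7))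

/-- No deletion touches `W`: its random vertices outside `T` have no edge leaving it, and its
vertices reach `T`, hence `U`, inside `W`. Every pass but the last deletes a vertex and is paid for
by `removeCost`; the last costs seven operations. -/
theorem run_prune [Finite V] (hI : Inv D A A U c) (hW : Winning D W) (hWA : W ⊆ A)
    (hTU : D.T ⊆ U)
    (h : ∀ (c' : Conf V) (A₁ : Set V), Inv D A₁ A₁ U c' → W ⊆ A₁ → A₁ ⊆ A →
      (∀ v ∈ A₁, v ∈ D.N → ∀ w, (v, w) ∈ D.E → w ∈ A₁) → (∀ v ∈ A₁, Leads D.E A₁ U v) →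
      c'.ops + A₁.ncard * removeCost V ≤ c.ops + A.ncard * removeCost V + 7 → Q c') :
    Run D.toEnv pruneProg c Q := by
  have hB := D.B_eq
  refine Run.seq (Run.assign ?_)
  simp only [Expr.eval]
  refine Run.loop (PruneInv D A U W (c.ops + A.ncard * removeCost V))
    (fun c' => (c'.vs 4).ncard + if c'.num 11 = 0 then 0 else 1) ?_ ?_ ?_
  · rintro c' ⟨A₁, hI₁, hWA₁, hAA₁, hd⟩ hb
    simp only [Expr.eval] at hb
    replace hd := (hd.resolve_right fun H => hb H.1).2
    simp only [hb, if_false, hI₁.v4]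
    refine Run.seq (Run.vertexOp (by simp only [Expr.eval]; omega) ?_)
    refine Run.seq (Run.pre (by simp only [Expr.eval]; omega) ?_)
    refine Run.seq (Run.vertexOp (by simp only [Expr.eval]; omega) ?_)
    refine Run.seq (Run.vertexOp (by simp only [Expr.eval]; omega) ?_)
    refine Run.seq (Run.card ?_)
    obtain ⟨X, hX⟩ : ∃ X : Set V, X = {v | ∃ w ∈ A₁ᶜ, (v, w) ∈ D.E} ∩ D.N ∩ A₁ := ⟨_, rfl⟩
    simp only [Expr.eval, SetOp.apply, Function.update_self, Function.update_idem,
      Function.update_of_ne (show (2 : ℕ) ≠ 5 by omega),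
      Function.update_of_ne (show (4 : ℕ) ≠ 5 by omega), hI₁.v0, hI₁.v2, hI₁.v4,
      ← Set.compl_eq_univ_sdiff, ← hX]
    have hXW : ∀ v ∈ X, v ∉ W := by
      rw [hX]
      rintro v ⟨⟨⟨w, hw, he⟩, hN⟩, -⟩ hv
      exact hw (hWA₁ (hW.random v hv hN w he))
    have hXA : X ⊆ A₁ := hX ▸ Set.inter_subset_right
    -- Both kinds of deletion end here. The overhead `labelSize V + 6` is five operations for the
    -- predecessor test plus `labelSize V + 1` for converting a label found by the search into a
    -- vertex.
    have remove : ∀ (c₂ : Conf V) (X : Set V), Inv D A₁ A₁ U c₂ → c₂.vs 5 = X → X ⊆ A₁ →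
        (∀ v ∈ X, v ∉ W) → X.Nonempty → c₂.num 11 ≠ 0 →
        c₂.ops ≤ c'.ops + labelSize V + 6 → Run D.toEnv removeProg c₂ fun c' =>
        PruneInv D A U W (c.ops + A.ncard * removeCost V) c' ∧
        ((c'.vs 4).ncard + if c'.num 11 = 0 then 0 else 1) < A₁.ncard + 1 := by
      intro c₂ X hI₂ h5 hXA hXW hne h11 hops
      refine run_remove hI₂ h5 hXA fun c₃ hI₃ _ hops₃ hn₃ => ?_
      have h11' : c₃.num 11 ≠ 0 := by rwa [hn₃ 11 (by omega) (by omega)]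
      have hpos : 0 < X.ncard := (Set.ncard_pos (Set.toFinite _)).2 hne
      have hcard := ncard_sdiff_add hXA
      refine ⟨⟨A₁ \ X, hI₃, fun v hv => ⟨hWA₁ hv, fun H => hXW v H hv⟩,
        Set.sdiff_subset.trans hAA₁, Or.inl ⟨h11', ?_⟩⟩, ?_⟩
      · have h1 : X.ncard * (labelSize V + 3) + (labelSize V + 8) ≤ X.ncard * removeCost V := by
          unfold removeCost
          nlinarith
        rw [← hcard, add_mul] at hd
        omega
      · simp only [h11', if_false, hI₃.v4]
        omega
    have hI₂ : ∀ k, Inv D A₁ A₁ U ⟨Function.update c'.num 11 k, Function.update c'.vs 5 X,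
        c'.ops + 1 + 1 + 1 + 1 + 1⟩ := by
      refine fun k => hI₁.congr (fun i hi => ?_) fun i hi => ?_
      · unfold NumKept at hi
        simp only [Function.update_of_ne (show i ≠ 11 by omega)]
      · unfold SetKept at hi
        simp only [Function.update_of_ne (show i ≠ 5 by omega)]
    refine Run.seq (Run.ite (fun hb => Run.skip ?_) fun hb => Run.seq ?_)
    · simp only [Expr.eval, Function.update_self] at hb
      refine remove _ X (hI₂ _) (by simp) hXA hXW (Set.nonempty_of_ncard_ne_zero hb)
        (by simpa using hb) ?_
      simp only
      omega
    · simp only [Expr.eval, Function.update_self] at hb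
      obtain rfl : X = ∅ := (Set.ncard_eq_zero (Set.toFinite _)).1 hb
      refine run_search (hI₂ _) fun c₃ hf hd₃ => ?_
      have h5₃ : c₃.vs 5 = ∅ := by rw [hf.vs]; simp
      have hops₃ := hf.ops
      have h11₃ : c₃.num 11 = 0 := by
        rw [hf.num 11 (by omega) (by omega) (by omega) (by omega)]
        simp
      simp only at hops₃
      refine Run.ite (fun hb₃ => Run.seq ?_) fun hb₃ => Run.skip ?_
      · simp only [Expr.eval] at hb₃
        obtain ⟨d, hdA, h9, hnl⟩ := hd₃.resolve_left fun H => hb₃ H.1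
        refine run_vertex h9 (hf.inv (hI₂ _)) fun c₄ h5₄ hvs₄ hops₄ hn₄ => Run.assign ?_
        simp only [Expr.eval]
        refine remove _ {d} ?_ h5₄ (by simpa using hdA) ?_ (Set.singleton_nonempty d) (by simp) ?_
        · refine (hf.inv (hI₂ _)).congr (fun i hi => ?_) fun i hi => ?_
          · unfold NumKept at hi
            simp only [Function.update_of_ne (show i ≠ 11 by omega)]
            exact hn₄ i (by omega)
          · unfold SetKept at hi
            exact hvs₄ i (by omega)
        · intro v hv hvW
          rw [Set.mem_singleton_iff.1 hv] at hvW
          exact hnl ((hW.leads d hvW).mono hWA₁ fun _ _ hT => hTU hT)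
        · simp only
          omega
      · simp only [Expr.eval] at hb₃
        have hl := (hd₃.resolve_right fun ⟨d, _, h9, _⟩ => by omega).2
        refine run_remove (hf.inv (hI₂ _)) h5₃ (Set.empty_subset _) fun c₄ hI₄ _ hops₄ hn₄ => ?_
        have h11' : c₄.num 11 = 0 := by rw [hn₄ 11 (by omega) (by omega), h11₃]
        rw [Set.sdiff_empty] at hI₄
        simp only [Set.ncard_empty, zero_mul] at hops₄
        refine ⟨⟨A₁, hI₄, hWA₁, hAA₁, Or.inr ⟨h11', fun v hv hN w he => ?_, hl, by omega⟩⟩, ?_⟩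
        · by_contra hw
          exact (Set.mem_empty_iff_false v).1 (hX ▸ ⟨⟨⟨w, hw, he⟩, hN⟩, hv⟩)
        · simp [h11', hI₄.v4]
  · rintro c' ⟨A₁, hI₁, hWA₁, hAA₁, hd⟩ hb
    simp only [Expr.eval] at hb
    obtain ⟨-, hR, hL, hops⟩ := hd.resolve_left fun H => H.1 hb
    exact h c' A₁ hI₁ hWA₁ hAA₁ hR hL hops
  · refine ⟨A, hI.congr (fun i hi => ?_) fun i _ => rfl, hWA, subset_rfl,
      Or.inl ⟨by simp, le_rfl⟩⟩
    unfold NumKept at hi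
    simp only [Function.update_of_ne (show i ≠ 11 by omega)]

/-- Backward search on the input edges, at five operations a pass. Each pass but the last adds a
vertex, so the search costs $O(n)$ operations; the deletions are charged to the candidates that
disappear. -/
theorem run_reach [Finite V] (hI : Inv D A A U c) (hTA : D.T ⊆ A)
    (h : ∀ c' : Conf V, Inv D {v | Leads D.E A D.T v} {v | Leads D.E A D.T v} U c' →
      c'.num 10 = (A \ {v | Leads D.E A D.T v}).ncard →
      c'.ops + {v | Leads D.E A D.T v}.ncard * removeCost V ≤
        c.ops + A.ncard * removeCost V + 5 * Nat.card V + 10 → Q c') :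
    Run D.toEnv reachProg c Q := by
  have hB := D.B_eq
  refine Run.seq (Run.vertexOp (by simp only [Expr.eval]; omega) ?_)
  refine Run.seq (Run.assign ?_)
  simp only [Expr.eval, SetOp.apply, Set.union_self, hI.v3]
  refine Run.seq (Run.loop (fun c' => Inv D A A U c' ∧ D.T ⊆ c'.vs 8 ∧
    (∀ v ∈ c'.vs 8, Leads D.E A D.T v) ∧
    (c'.num 13 = 0 → ∀ v ∈ A, ∀ w ∈ c'.vs 8, (v, w) ∈ D.E → v ∈ c'.vs 8) ∧
    c'.ops ≤ c.ops + 1 + 5 * (c'.vs 8).ncard + if c'.num 13 = 0 then 5 else 0)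
    (fun c' => (Nat.card V - (c'.vs 8).ncard) + if c'.num 13 = 0 then 0 else 1) ?_ ?_ ?_)
  · rintro c' ⟨hI', hT, hS, -, hops⟩ hb
    simp only [Expr.eval] at hb
    simp only [hb, if_false] at hops ⊢
    refine Run.seq (Run.pre (by simp only [Expr.eval]; omega) ?_)
    refine Run.seq (Run.vertexOp (by simp only [Expr.eval]; omega) ?_)
    refine Run.seq (Run.vertexOp (by simp only [Expr.eval]; omega) ?_)
    refine Run.seq (Run.vertexOp (by simp only [Expr.eval]; omega) (Run.card ?_))
    obtain ⟨R, hR⟩ : ∃ R, R = c'.vs 8 := ⟨_, rfl⟩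
    obtain ⟨Y, hY⟩ : ∃ Y : Set V, Y = ({v | ∃ w ∈ R, (v, w) ∈ D.E} ∩ A) \ R := ⟨_, rfl⟩
    simp only [Expr.eval, SetOp.apply, Function.update_self, Function.update_idem,
      Function.update_of_ne (show (4 : ℕ) ≠ 9 by omega),
      Function.update_of_ne (show (8 : ℕ) ≠ 9 by omega),
      Function.update_of_ne (show (9 : ℕ) ≠ 8 by omega), hI'.v4, ← hR, ← hY]
    rw [← hR] at hT hS hops
    have hdisj : Disjoint R Y := by
      rw [hY]
      exact Set.disjoint_sdiff_right
    have hcard : (R ∪ Y).ncard = R.ncard + Y.ncard :=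
      Set.ncard_union_eq hdisj (Set.toFinite _) (Set.toFinite _)
    have hle : (R ∪ Y).ncard ≤ Nat.card V := Set.ncard_le_card _
    refine ⟨⟨hI'.congr (fun i hi => ?_) (fun i hi => ?_), hT.trans Set.subset_union_left, ?_, ?_,
      ?_⟩, ?_⟩
    · unfold NumKept at hi
      simp only [Function.update_of_ne (show i ≠ 13 by omega)]
    · unfold SetKept at hi
      simp only [Function.update_of_ne (show i ≠ 8 by omega),
        Function.update_of_ne (show i ≠ 9 by omega)]
    · rintro v (hv | hv)
      · exact hS v hv
      · rw [hY] at hv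
        obtain ⟨⟨⟨w, hw, he⟩, hA⟩, -⟩ := hv
        exact .step hA he (hS w hw)
    · intro h0 v hv w hw he
      have hY0 : Y = ∅ := (Set.ncard_eq_zero (Set.toFinite _)).1 h0
      rw [hY0, Set.union_empty] at hw ⊢
      by_contra hvR
      exact (Set.mem_empty_iff_false v).1 (hY0 ▸ hY ▸ ⟨⟨⟨w, hw, he⟩, hv⟩, hvR⟩)
    · split_ifs <;> omega
    · split_ifs <;> omega
  · rintro c' ⟨hI', hT, hS, hcl, hops⟩ hb
    simp only [Expr.eval] at hb
    have hR : c'.vs 8 = {v | Leads D.E A D.T v} := by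
      refine Set.Subset.antisymm hS fun v hv => ?_
      induction hv with
      | base _ hvT => exact hT hvT
      | step hv he _ ih => exact hcl hb _ hv _ ih he
    simp only [hb, if_true] at hops
    refine Run.seq (Run.vertexOp (by simp only [Expr.eval]; omega) (Run.seq (Run.card ?_)))
    simp only [Expr.eval, SetOp.apply, hI'.v4, hR, Function.update_self]
    have hRA : {v | Leads D.E A D.T v} ⊆ A := fun v hv => Leads.mem hv
    refine run_remove (A := A) (U := U) (X := A \ {v | Leads D.E A D.T v})
      (hI'.congr (fun i hi => ?_) (fun i hi => ?_)) (by simp) Set.sdiff_subset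
      fun c₂ hI₂ _ hops₂ hn₂ => ?_
    · unfold NumKept at hi
      simp only [Function.update_of_ne (show i ≠ 10 by omega)]
    · unfold SetKept at hi
      simp only [Function.update_of_ne (show i ≠ 5 by omega)]
    · rw [Set.sdiff_sdiff_cancel_left hRA] at hI₂
      refine h c₂ hI₂ (by rw [hn₂ 10 (by omega) (by omega)]; simp) ?_
      have h1 := ncard_sdiff_add hRA
      have h2 : (A \ {v | Leads D.E A D.T v}).ncard * (labelSize V + 3) ≤
          (A \ {v | Leads D.E A D.T v}).ncard * removeCost V :=
        Nat.mul_le_mul_left _ (by unfold removeCost; omega)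
      have h3 : (c'.vs 8).ncard ≤ Nat.card V := Set.ncard_le_card _
      rw [← h1, add_mul]
      simp only at hops₂
      omega
  · refine ⟨hI.congr (fun i hi => ?_) (fun i hi => ?_), by simp, ?_, by simp, ?_⟩
    · unfold NumKept at hi
      simp only [Function.update_of_ne (show i ≠ 13 by omega)]
    · unfold SetKept at hi
      simp only [Function.update_of_ne (show i ≠ 8 by omega)]
    · simp only [Function.update_self]
      exact fun v hv => .base (hTA hv) hv
    · simp only [Function.update_self]
      omega

end Symbolic

/-! ### Labelling the vertices, and the main loop. -/

namespace Symbolic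

/-- Add the vertex in the vertex-set cell `7` to the sets that belong to the bits of its label, the
content of the number cell `3`. -/
def addBitsProg : Prog :=
  forLoop 4 (cell 2)
    (.ite (.mod (.div (cell 3) (.pow (.const 2) (cell 4))) (.const 2))
      (.op (.vertexOp .union (bitCell (cell 4)) (bitCell (cell 4)) (lit 7))) .skip)

/-- Initialize the variables, and label the vertices. -/
def setupProg : Prog :=
  .seq (.op (.card (lit 1) (lit 0)))
    (.seq (.assign (lit 2) (.add (.log (cell 1)) (.const 1)))
      (.seq (.op (.vertexOp .diff (lit 2) (lit 2) (lit 3)))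
        (.seq (.op (.vertexOp .union (lit 4) (lit 0) (lit 0)))
          (.seq (.op (.vertexOp .union (lit 10) (lit 0) (lit 0)))
            (.seq (.op (.vertexOp .union (lit 6) (lit 0) (lit 0)))
              (forEach 6 7
                (.seq addBitsProg
                  (.seq (.assign (entry 32 (cell 3)) (.const 1))
                    (.seq (.assign (entry 33 (cell 3)) (.const 1))
                      (.assign (lit 3) (.add (cell 3) (.const 1))))))))))))

/-- The main loop. -/
def mainLoop : Prog :=
  .seq (.assign (lit 10) (.const 1))
    (.loop (cell 10) (.seq scanProg (.seq pruneProg reachProg)))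

/-- The algorithm for almost-sure reachability, up to the final copy of the result. -/
def candidateProg : Prog := .seq setupProg mainLoop

variable {V : Type*} {D : Inst V} {c : Conf V} {Q : Conf V → Prop} {A A' U W : Set V}

theorem run_addBits {cx : Env V} {v : V} {i : ℕ} (hB : cx.B = 16 + labelSize V)
    (h2 : c.num 2 = labelSize V) (h3 : c.num 3 = i) (h7 : c.vs 7 = {v})
    (h : ∀ c' : Conf V, (∀ b < labelSize V, ∀ u, u ∈ c'.vs (16 + b) ↔
        u ∈ c.vs (16 + b) ∨ (u = v ∧ i.testBit b)) →
      (∀ j < 16, c'.vs j = c.vs j) → (∀ j ≠ 4, c'.num j = c.num j) →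
      c'.ops ≤ c.ops + labelSize V → Q c') : Run cx addBitsProg c Q := by
  refine Run.forLoop (N := labelSize V) (fun k c' => (∀ b, ∀ u, u ∈ c'.vs (16 + b) ↔
        u ∈ c.vs (16 + b) ∨ (b < k ∧ u = v ∧ i.testBit b)) ∧
      (∀ j < 16, c'.vs j = c.vs j) ∧ (∀ j ≠ 4, c'.num j = c.num j) ∧
      c'.ops ≤ c.ops + k) ?_ ?_ ?_ ?_
  · rintro k c' ⟨-, -, hn, -⟩ -
    simp only [Expr.eval, hn 2 (by omega), h2]
  · refine ⟨fun b u => by simp, fun _ _ => rfl, fun j hj => ?_, le_rfl⟩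
    simp only [Function.update_of_ne hj]
  · rintro k c' hk h4 ⟨hbit, hvs, hn, hops⟩
    have hlt : ∀ b : ℕ, b < k + 1 ↔ b < k ∨ b = k := fun b => by omega
    have htb : i.testBit k = decide (i / 2 ^ k % 2 = 1) := Nat.testBit_eq_decide_div_mod_eq
    have hn' : ∀ j ≠ 4, Function.update c'.num 4 (k + 1) j = c.num j := fun j hj => by
      rw [Function.update_of_ne hj, hn j hj]
    refine Run.ite (fun hb => ?_) (fun hb => Run.skip ?_)
    · simp only [Expr.eval, hn 3 (by omega), h3, h4] at hb
      have hb1 : i / 2 ^ k % 2 = 1 := by omega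
      refine Run.vertexOp (by simp only [Expr.eval]; omega) ?_
      simp only [Expr.eval, SetOp.apply, h4, hvs 7 (by omega), h7]
      refine ⟨trivial, fun b u => ?_, fun j hj => ?_, hn', by omega⟩
      · by_cases hbk : b = k
        · subst hbk
          rw [Function.update_self]
          simp [hbit, htb, hb1, or_comm]
        · rw [Function.update_of_ne (by omega), hbit, hlt]
          simp [hbk]
      · rw [Function.update_of_ne (by omega), hvs j hj]
    · simp only [Expr.eval, hn 3 (by omega), h3, h4] at hb
      refine ⟨h4, fun b u => ?_, hvs, hn', ?_⟩
      · rw [hbit, hlt]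
        by_cases hbk : b = k
        · subst hbk
          simp [htb, hb]
        · simp [hbk]
      · simp only
        omega
  · rintro c' ⟨hbit, hvs, hn, hops⟩
    refine h c' (fun b hb u => ?_) hvs hn hops
    rw [hbit]
    simp [hb]

/-- The invariant of the labelling loop: the vertices outside `Z` have been labelled. -/
structure SetupInv (T N Z : Set V) (p : ℕ) (lab : V → ℕ) (c : Conf V) : Prop where
  n0 : c.num 0 = p
  n1 : c.num 1 = Nat.card V
  n2 : c.num 2 = labelSize V
  n3 : c.num 3 + Z.ncard = Nat.card V
  v0 : c.vs 0 = Set.univ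
  v2 : c.vs 2 = N
  v3 : c.vs 3 = T
  v4 : c.vs 4 = Set.univ
  v10 : c.vs 10 = Set.univ
  inj : ∀ u v, u ∉ Z → v ∉ Z → lab u = lab v → u = v
  lt : ∀ v, v ∉ Z → lab v < c.num 3
  bits : ∀ b < labelSize V, ∀ v, v ∈ c.vs (16 + b) ↔ v ∉ Z ∧ (lab v).testBit b
  alive : ∀ i, c.num (4 * i + 32) ≠ 0 ↔ ∃ v, v ∉ Z ∧ lab v = i
  unread : ∀ v, v ∉ Z → c.num (4 * lab v + 33) ≠ 0
  adj : ∀ i, c.num (4 * i + 35) = 0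
  cost : c.ops + Z.ncard * (labelSize V + 3) ≤ 6 + Nat.card V * (labelSize V + 3)

/-- The counter exceeds all labels given so far, so assigning its value to `v` keeps the labelling
injective. The labelling is existential because it depends on the order of the picks. -/
theorem SetupInv.step [Finite V] {T N Z : Set V} {p : ℕ} {lab : V → ℕ} {v : V}
    {c' : Conf V} (h : SetupInv T N Z p lab c) (hv : v ∈ Z)
    (hbit : ∀ b < labelSize V, ∀ u, u ∈ c'.vs (16 + b) ↔
        u ∈ c.vs (16 + b) ∨ (u = v ∧ (c.num 3).testBit b))
    (hvs : ∀ j, j ≠ 6 → j ≠ 7 → j < 16 → c'.vs j = c.vs j) (h3 : c'.num 3 = c.num 3 + 1)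
    (h32 : c'.num (4 * c.num 3 + 32) = 1) (h33 : c'.num (4 * c.num 3 + 33) = 1)
    (hn : ∀ j, j ≠ 3 → j ≠ 4 → j ≠ 6 → j ≠ 4 * c.num 3 + 32 → j ≠ 4 * c.num 3 + 33 →
      c'.num j = c.num j)
    (hops : c'.ops ≤ c.ops + labelSize V + 3) :
    ∃ lab', SetupInv T N (Z \ {v}) p lab' c' := by
  classical
  have hlab : ∀ u, u ∉ Z → Function.update lab v (c.num 3) u = lab u := fun u hu =>
    Function.update_of_ne (fun he : u = v => hu (he ▸ hv)) _ _
  have hmem : ∀ u, u ∉ Z \ {v} ↔ u ∉ Z ∨ u = v := fun u => by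
    simp only [Set.mem_sdiff, Set.mem_singleton_iff, not_and, not_not]
    tauto
  have hc := ncard_sdiff_singleton_add_one hv
  refine ⟨Function.update lab v (c.num 3), ?_, ?_, ?_, ?_, ?_, ?_, ?_, ?_, ?_, ?_, ?_, ?_, ?_, ?_,
    ?_, ?_⟩
  · rw [hn 0 (by omega) (by omega) (by omega) (by omega) (by omega), h.n0]
  · rw [hn 1 (by omega) (by omega) (by omega) (by omega) (by omega), h.n1]
  · rw [hn 2 (by omega) (by omega) (by omega) (by omega) (by omega), h.n2]
  · have := h.n3
    omega
  · rw [hvs 0 (by omega) (by omega) (by omega), h.v0]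
  · rw [hvs 2 (by omega) (by omega) (by omega), h.v2]
  · rw [hvs 3 (by omega) (by omega) (by omega), h.v3]
  · rw [hvs 4 (by omega) (by omega) (by omega), h.v4]
  · rw [hvs 10 (by omega) (by omega) (by omega), h.v10]
  · intro x y hx hy he
    rw [hmem] at hx hy
    rcases hx with hx | rfl <;> rcases hy with hy | rfl
    · rw [hlab x hx, hlab y hy] at he
      exact h.inj x y hx hy he
    · rw [hlab x hx, Function.update_self] at he
      exact absurd he (h.lt x hx).ne
    · rw [hlab y hy, Function.update_self] at he
      exact absurd he.symm (h.lt y hy).ne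
    · rfl
  · intro x hx
    rcases (hmem x).1 hx with hx | rfl
    · rw [hlab x hx, h3]
      exact (h.lt x hx).trans (Nat.lt_succ_self _)
    · rw [Function.update_self, h3]
      exact Nat.lt_succ_self _
  · intro b hb x
    rw [hbit b hb, h.bits b hb, hmem]
    by_cases hxv : x = v
    · subst hxv
      simp [hv]
    · rw [Function.update_of_ne hxv]
      simp [hxv]
  · intro i
    by_cases hi : i = c.num 3
    · subst hi
      rw [h32]
      exact iff_of_true one_ne_zero ⟨v, (hmem v).2 (Or.inr rfl), Function.update_self _ _ _⟩
    · rw [hn _ (by omega) (by omega) (by omega) (by omega) (by omega), h.alive]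
      constructor
      · rintro ⟨u, hu, rfl⟩
        exact ⟨u, (hmem u).2 (Or.inl hu), hlab u hu⟩
      · rintro ⟨u, hu, rfl⟩
        rcases (hmem u).1 hu with hu | rfl
        · exact ⟨u, hu, (hlab u hu).symm⟩
        · exact absurd (Function.update_self _ _ _) hi
  · intro u hu
    rcases (hmem u).1 hu with hu | rfl
    · rw [hlab u hu, hn _ (by omega) (by omega) (by omega) (by omega)
        (by have := h.lt u hu; omega)]
      exact h.unread u hu
    · rw [Function.update_self, h33]
      exact one_ne_zero
  · intro i
    rw [hn _ (by omega) (by omega) (by omega) (by omega) (by omega), h.adj]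
  · have := h.cost
    rw [hc, add_mul] at this
    omega

/-- The continuation is quantified over `D` because the labels are known only after the picks of
this phase. -/
theorem run_setup [Finite V] {cx : Env V} {T R : Set V} {p : ℕ} (hB : cx.B = 16 + labelSize V)
    (hnum : ∀ i, c.num i = if i = 0 then p else 0) (h0 : c.vs 0 = Set.univ) (h2 : c.vs 2 = R)
    (h3 : c.vs 3 = T) (hvs : ∀ i, 16 ≤ i → c.vs i = ∅) (hops : c.ops = 0)
    (h : ∀ (D : Inst V) (c' : Conf V), D.toEnv = cx → D.T = T → D.N = R \ T → D.p = p →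
      Inv D Set.univ Set.univ Set.univ c' →
      c'.ops ≤ 6 + Nat.card V * (labelSize V + 3) → Q c') : Run cx setupProg c Q := by
  refine Run.seq (Run.card ?_)
  refine Run.seq (Run.assign ?_)
  refine Run.seq (Run.vertexOp (by simp only [Expr.eval]; omega) ?_)
  refine Run.seq (Run.vertexOp (by simp only [Expr.eval]; omega) ?_)
  refine Run.seq (Run.vertexOp (by simp only [Expr.eval]; omega) ?_)
  refine Run.seq (Run.vertexOp (by simp only [Expr.eval]; omega) ?_)
  simp only [Expr.eval, SetOp.apply, Function.update_self, Set.union_self,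
    Function.update_of_ne (show (0 : ℕ) ≠ 2 by omega),
    Function.update_of_ne (show (0 : ℕ) ≠ 4 by omega),
    Function.update_of_ne (show (0 : ℕ) ≠ 10 by omega), h0, h2, h3, Set.ncard_univ]
  refine Run.forEach (fun Z c' => ∃ lab, SetupInv T (R \ T) Z p lab c') (by omega) (by omega)
    (by omega) ?_ ?_ ?_
  · simp only [Function.update_self]
    refine ⟨fun _ => 0, ?_⟩
    constructor
    case bits =>
      intro b hb v
      simp only [Function.update_of_ne (show 16 + b ≠ 6 by omega),
        Function.update_of_ne (show 16 + b ≠ 10 by omega),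
        Function.update_of_ne (show 16 + b ≠ 4 by omega),
        Function.update_of_ne (show 16 + b ≠ 2 by omega), hvs (16 + b) (by omega)]
      simp
    case alive =>
      intro i
      simp only [Function.update_of_ne (show 4 * i + 32 ≠ 6 by omega),
        Function.update_of_ne (show 4 * i + 32 ≠ 2 by omega),
        Function.update_of_ne (show 4 * i + 32 ≠ 1 by omega), hnum]
      simp
    case adj =>
      intro i
      simp only [Function.update_of_ne (show 4 * i + 35 ≠ 6 by omega),
        Function.update_of_ne (show 4 * i + 35 ≠ 2 by omega),
        Function.update_of_ne (show 4 * i + 35 ≠ 1 by omega), hnum]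
      simp
    case n2 => simp [labelSize]
    all_goals simp [hnum, h0, h3, hops, Set.ncard_univ]
  · rintro Z c₁ v hv hz ⟨lab, hS⟩
    refine Run.seq (run_addBits (v := v) hB hS.n2 rfl (by simp) fun c₂ hbit₂ hvs₂ hn₂ hops₂ => ?_)
    refine Run.seq (Run.assign ?_)
    refine Run.seq (Run.assign (Run.assign ?_))
    have h3₂ := hn₂ 3 (by omega)
    simp only at h3₂ hops₂
    simp only [Expr.eval, h3₂, Function.update_of_ne (show 3 ≠ 4 * c₁.num 3 + 32 by omega),
      Function.update_of_ne (show 3 ≠ 4 * c₁.num 3 + 33 by omega)]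
    refine ⟨by rw [hvs₂ 6 (by omega)]; simp, hS.step hv (fun b hb u => ?_) (fun j h6 h7 hj => ?_)
      ?_ ?_ ?_ (fun j i3 i4 i6 i32 i33 => ?_) (by simp only; omega)⟩
    · rw [hbit₂ b hb]
      simp only [Function.update_of_ne (show 16 + b ≠ 6 by omega),
        Function.update_of_ne (show 16 + b ≠ 7 by omega)]
    · rw [hvs₂ j hj]
      simp only [Function.update_of_ne h6, Function.update_of_ne h7]
    · simp
    · simp only [Function.update_of_ne (show 4 * c₁.num 3 + 32 ≠ 6 by omega),
        Function.update_of_ne (show 4 * c₁.num 3 + 32 ≠ 3 by omega),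
        Function.update_of_ne (show 4 * c₁.num 3 + 32 ≠ 4 * c₁.num 3 + 33 by omega),
        Function.update_self]
    · simp only [Function.update_of_ne (show 4 * c₁.num 3 + 33 ≠ 6 by omega),
        Function.update_of_ne (show 4 * c₁.num 3 + 33 ≠ 3 by omega), Function.update_self]
    · simp only [Function.update_of_ne i3, Function.update_of_ne i6, Function.update_of_ne i32,
        Function.update_of_ne i33, hn₂ j i4]
  · rintro c₁ - ⟨lab, hS⟩
    have hcard := hS.n3
    rw [Set.ncard_empty, add_zero] at hcard
    refine h ⟨cx, T, R \ T, p, lab, ?_, ?_, hB⟩ c₁ rfl rfl rfl rfl ?_ ?_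
    · exact fun u v he => hS.inj u v (Set.notMem_empty _) (Set.notMem_empty _) he
    · exact fun v => hcard ▸ hS.lt v (Set.notMem_empty _)
    · refine ⟨hS.n0, hS.n1, hS.n2, hS.v0, hS.v2, hS.v3, hS.v4, hS.v10, fun b hb v => ?_,
        fun i => ?_, fun v => ?_, fun u w hne => ?_, fun u w hu => ?_⟩
      · rw [hS.bits b hb]
        simp
      · rw [hS.alive]
        simp
      · exact iff_of_true (hS.unread v (Set.notMem_empty _)) (Set.mem_univ v)
      · exact absurd (hS.adj _) hne
      · exact absurd (Set.mem_univ u) hu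
    · have := hS.cost
      simpa using this

/-- The cost of a round of the main loop, apart from the removals and the reading of edges. -/
noncomputable def roundCost (V : Type*) : ℕ := 11 * Nat.card V + 20

/-- The invariant of the main loop, where `k` is the amortized cost before the loop. -/
def MainInv (D : Inst V) (W : Set V) (k : ℕ) (c : Conf V) : Prop :=
  ∃ (A U : Set V) (r : ℕ), Inv D A A U c ∧ W ⊆ A ∧ D.T ⊆ U ∧ (D.p + 1) * r + A.ncard ≤ Nat.card V ∧
    ((c.num 10 ≠ 0 ∧
        c.ops + U.ncard * readCost D + A.ncard * removeCost V ≤ k + r * roundCost V) ∨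
      (c.num 10 = 0 ∧ A = W ∧ c.ops ≤ k + (r + 1) * roundCost V))

/-- The bound on the number `r` of rounds that continue the loop comes from the clause `(D.p + 1) *
r + A.ncard ≤ Nat.card V` of `MainInv`: each such round shrinks the candidate set by at least `D.p +
1`. Reading and deleting are paid by the two potentials in the same invariant. -/
theorem run_mainLoop [Finite V] (hI : Inv D Set.univ Set.univ Set.univ c) (hW : Winning D W)
    (hmax : ∀ A : Set V, (∀ v ∈ A, v ∈ D.N → ∀ w, (v, w) ∈ D.E → w ∈ A) →
      (∀ v ∈ A, Leads D.E A D.T v) → A ⊆ W)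
    (h : ∀ (c' : Conf V) (r : ℕ), c'.vs 4 = W → (D.p + 1) * r ≤ Nat.card V →
      c'.ops ≤ c.ops + Nat.card V * readCost D + Nat.card V * removeCost V +
        (r + 1) * roundCost V → Q c') :
    Run D.toEnv mainLoop c Q := by
  refine Run.seq (Run.assign ?_)
  simp only [Expr.eval]
  refine Run.loop (MainInv D W
    (c.ops + Nat.card V * readCost D + Nat.card V * removeCost V))
    (fun c' => (c'.vs 4).ncard + if c'.num 10 = 0 then 0 else 1) ?_ ?_ ?_
  · rintro c₁ ⟨A, U, r, hI₁, hWA, hTU, hr, hd⟩ hb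
    simp only [Expr.eval] at hb
    replace hd := (hd.resolve_right fun H => hb H.1).2
    simp only [hb, if_false, hI₁.v4]
    refine Run.seq (run_scan hI₁ hTU fun c₂ U₂ hI₂ hTU₂ hdeg hops₂ => ?_)
    refine Run.seq (run_prune hI₂ hW hWA hTU₂ fun c₃ A₃ hI₃ hWA₃ hAA₃ hR₃ hL₃ hops₃ => ?_)
    refine run_reach hI₃ (hW.target.trans hWA₃) fun c₄ hI₄ h10 hops₄ => ?_
    have hWL : W ⊆ {v | Leads D.E A₃ D.T v} := fun v hv =>
      (hW.leads v hv).mono hWA₃ fun _ _ hT => hT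
    have hLA : {v | Leads D.E A₃ D.T v} ⊆ A₃ := fun v hv => Leads.mem hv
    have hcost : c₄.ops + U₂.ncard * readCost D +
        {v | Leads D.E A₃ D.T v}.ncard * removeCost V ≤ c.ops + Nat.card V * readCost D +
          Nat.card V * removeCost V + (r + 1) * roundCost V := by
      rw [add_mul r 1]
      unfold roundCost at hd ⊢
      omega
    -- If the backward search deletes nothing, the pruned set has both closure properties and is
    -- contained in `W` by maximality.
    by_cases hX : A₃ ⊆ {v | Leads D.E A₃ D.T v}
    · have hAW : A₃ = W := Set.Subset.antisymm (hmax A₃ hR₃ fun v hv => hX hv) hWA₃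
      have hLW : {v | Leads D.E A₃ D.T v} = W := (Set.Subset.antisymm hLA hX).trans hAW
      have h10' : c₄.num 10 = 0 := by rw [h10, Set.sdiff_eq_empty.2 hX, Set.ncard_empty]
      have hle : W.ncard ≤ A.ncard := Set.ncard_le_ncard hWA (Set.toFinite _)
      rw [hLW] at hI₄ hcost
      refine ⟨⟨W, U₂, r, hI₄, subset_rfl, hTU₂, by omega, Or.inr ⟨h10', rfl, by omega⟩⟩, ?_⟩
      simp only [h10', if_true, hI₄.v4]
      omega
    -- After pruning every candidate reaches `U₂`; if all candidates in `U₂` reached `T`,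
    -- concatenating paths would leave nothing to delete.
    · obtain ⟨u, huA, huU, huL⟩ : ∃ u ∈ A₃, u ∈ U₂ ∧ ¬ Leads D.E A₃ D.T u := by
        by_contra hno
        push Not at hno
        exact hX fun v hv => (hL₃ v hv).trans fun x hx hxU => hno x hx hxU
      have hlt := hdeg u (hAA₃ huA) huU fun hT => huL (.base huA hT)
      -- A surviving successor would give `u` a path to `T`. The successors are counted in the set
      -- `A` at the start of the round, so those deleted by pruning count as well.
      have hsub : succIn D.E A u ⊆ A \ {v | Leads D.E A₃ D.T v} := fun w hw =>
        ⟨hw.2, fun hl => huL (.step huA hw.1 hl)⟩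
      have hle := Set.ncard_le_ncard hsub (Set.toFinite _)
      have hcard := ncard_sdiff_add (hLA.trans hAA₃)
      have h10' : c₄.num 10 ≠ 0 := by
        rw [h10]
        exact fun h0 => hX (Set.sdiff_eq_empty.1 ((Set.ncard_eq_zero (Set.toFinite _)).1 h0))
      refine ⟨⟨_, U₂, r + 1, hI₄, hWL, hTU₂, by rw [mul_add, mul_one]; omega,
        Or.inl ⟨h10', hcost⟩⟩, ?_⟩
      simp only [h10', if_false, hI₄.v4]
      omega
  · rintro c₁ ⟨A, U, r, hI₁, -, -, hr, hd⟩ hb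
    simp only [Expr.eval] at hb
    obtain ⟨-, rfl, hops⟩ := hd.resolve_left fun H => H.1 hb
    exact h c₁ r hI₁.v4 (by omega) hops
  · refine ⟨Set.univ, Set.univ, 0, hI.congr (fun i hi => ?_) fun i _ => rfl, Set.subset_univ _,
      Set.subset_univ _, by rw [Set.ncard_univ]; omega, Or.inl ⟨by simp, ?_⟩⟩
    · unfold NumKept at hi
      simp only [Function.update_of_ne (show i ≠ 10 by omega)]
    · simp only [Set.ncard_univ]
      omega

end Symbolic

/-! ### The assembled algorithm and its bounds. -/

namespace Symbolic

/-- The algorithm for almost-sure reachability. -/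
def almostSureReachProg : Prog :=
  .seq candidateProg (.op (.vertexOp .union (lit 0) (lit 4) (lit 4)))

theorem run_candidate {V : Type*} [Fintype V] [MeasurableSpace V] [DiscreteMeasurableSpace V]
    (P : MDP V) (T : Set V) (ρ : Picker V) (p : ℕ) :
    Run ⟨ρ, 16 + labelSize V, P.E⟩ candidateProg (init P T p).conf fun c =>
      c.vs 4 = P.ASW (P.Reach T) ∧ ∃ r, (p + 1) * r ≤ Nat.card V ∧
        c.ops ≤ 6 + Nat.card V * (labelSize V + 3) +
          Nat.card V * (labelSize V + 2 + p * (labelSize V + 3)) +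
          Nat.card V * (2 * labelSize V + 11) + (r + 1) * (11 * Nat.card V + 20) := by
  refine Run.seq (run_setup (T := T) (R := P.VR) (p := p) rfl ?_ ?_ ?_ ?_ ?_ ?_ ?_)
  · exact fun i => rfl
  · simp [State.conf, init, State.track]
  · simp [State.conf, init, State.track]
  · simp [State.conf, init, State.track]
  · intro i hi
    have h0 : i ≠ 0 := by omega
    have h1 : i ≠ 1 := by omega
    have h2 : i ≠ 2 := by omega
    have h3 : i ≠ 3 := by omega
    simp [State.conf, init, State.track, h0, h1, h2, h3]
  · rfl
  intro D c hE hT hN hp hI hops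
  have hDE : D.E = P.E := by rw [hE]
  rw [← hE]
  refine run_mainLoop (W := P.ASW (P.Reach T)) hI ⟨?_, ?_, ?_⟩ ?_ fun c' r h4 hr hops' => ?_
  · rw [hT]
    exact P.subset_asw_reach T
  · rw [hN, hDE]
    exact fun v hv hvN w he => P.asw_reach_random hv hvN.1 hvN.2 he
  · rw [hT, hDE]
    exact fun v hv => P.asw_reach_leads hv
  · rw [hT, hN, hDE]
    exact fun A hR hL => P.subset_asw_of_closed (fun v hv hvR hvT => hR v hv ⟨hvR, hvT⟩) hL
  · rw [hp] at hr
    refine ⟨h4, r, hr, ?_⟩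
    simp only [readCost, removeCost, roundCost, hp] at hops'
    omega

theorem fits_init {V : Type*} (P : MDP V) (T : Set V) (ρ : Picker V) (p : ℕ) :
    Env.Fits ⟨ρ, 16 + labelSize V, P.E⟩ (init P T p) := by
  have hv : ∀ i, 16 + labelSize V ≤ i → (init P T p).vset i = none := by
    intro i hi
    have h0 : i ≠ 0 := by omega
    have h1 : i ≠ 1 := by omega
    have h2 : i ≠ 2 := by omega
    have h3 : i ≠ 3 := by omega
    simp [init, State.track, h0, h1, h2, h3]
  have he : ∀ i, i ≠ 0 → (init P T p).eset i = none := by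
    intro i h0
    simp [init, State.track, h0]
  exact ⟨hv, he, by simp [init, State.track], max_le (zero_le) (stored_le hv he)⟩

theorem computes_asw {V : Type*} [Fintype V] [MeasurableSpace V] [DiscreteMeasurableSpace V]
    (P : MDP V) (T : Set V) (ρ : Picker V) (p : ℕ) :
    ∃ s, Computes ρ almostSureReachProg P T p (P.ASW (P.Reach T)) s ∧
      s.peak ≤ (17 + labelSize V : ℕ) ∧ ∃ r, (p + 1) * r ≤ Nat.card V ∧
        s.ops ≤ 7 + Nat.card V * (labelSize V + 3) +
          Nat.card V * (labelSize V + 2 + p * (labelSize V + 3)) +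
          Nat.card V * (2 * labelSize V + 11) + (r + 1) * (11 * Nat.card V + 20) := by
  obtain ⟨t, h1, h2, h4, r, hr, hops⟩ :=
    run_candidate P T ρ p (init P T p) (fits_init P T ρ p) rfl
  refine ⟨_, ⟨.seq h1 (.op _ t), ?_⟩, ?_, r, hr, ?_⟩
  · simp only [State.conf] at h4
    simp [State.perform, State.effect, State.track, State.putV, State.val, Expr.eval, State.getV,
      SetOp.apply, h4]
  · have := ((h2.putV (lit 0) (some (t.getV (lit 4) ∪ t.getV (lit 4)))
      (by simp [State.val, Expr.eval])).track (t.ops + 1)).peak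
    refine this.trans ?_
    norm_cast
    simp only
    omega
  · change t.ops + 1 ≤ _
    simp only [State.conf] at hops
    omega

/-- Both the integral binary logarithm and the summand `1` are at most `log n / log 2`, and `2 / log
2 < 3`. -/
theorem labelSize_le_log {V : Type*} (hn : 2 ≤ Nat.card V) :
    (labelSize V : ℝ) ≤ 3 * Real.log (Nat.card V) := by
  have h2 : (0.6931471803 : ℝ) < Real.log 2 := Real.log_two_gt_d9
  have hn' : (2 : ℝ) ≤ Nat.card V := by exact_mod_cast hn
  have hlog : Real.log 2 ≤ Real.log (Nat.card V) := Real.log_le_log two_pos hn'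
  have hp : (2 : ℝ) ^ Nat.log 2 (Nat.card V) ≤ Nat.card V := by
    exact_mod_cast Nat.pow_log_le_self 2 (by omega)
  have := Real.log_le_log (by positivity) hp
  rw [Real.log_pow] at this
  unfold labelSize
  push_cast
  nlinarith [(Nat.cast_nonneg (Nat.log 2 (Nat.card V)) : (0 : ℝ) ≤ _)]

end Symbolic

/-- Without self-loops, the outgoing edge of a vertex provides a second vertex. This keeps `log n`
away from zero. -/
theorem MDP.two_le_card {V : Type*} [Finite V] [Nonempty V] (P : MDP V) : 2 ≤ Nat.card V := by
  obtain ⟨v⟩ := ‹Nonempty V›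
  obtain ⟨w, hw⟩ := P.exists_out v
  have hne : v ≠ w := fun h => P.no_loop v (by rwa [← h] at hw)
  have : Nontrivial V := ⟨v, w, hne⟩
  exact Finite.one_lt_card

/-- The arithmetic of the time bound, where `x = n ^ ε`, `y = n ^ (2 - ε)`. -/
theorem cost_bound {n p r L x y : ℝ} (hn : 2 ≤ n) (hL : 1 ≤ L) (hx : 1 ≤ x)
    (hp : p ≤ x + 1) (hp' : x ≤ p) (hr : 0 ≤ r) (hpr : (p + 1) * r ≤ n) (hxy : x * y = n ^ 2)
    (hny : n ≤ y) (hnx : n * x ≤ y) :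
    7 + n * (L + 3) + n * (L + 2 + p * (L + 3)) + n * (2 * L + 11) + (r + 1) * (11 * n + 20) ≤
      100 * y * L := by
  have hy : 0 < y := by linarith
  have hrn : n * r ≤ y := by
    -- The lower bound `x ≤ p` limits the rounds; the upper bound `p ≤ x + 1` is needed for the cost
    -- of reading.
    have h1 : x * r ≤ n := by nlinarith
    have h2 : x * (n * r) ≤ x * y := by rw [hxy]; nlinarith
    exact le_of_mul_le_mul_left h2 (by linarith)
  have hnp : n * p ≤ 2 * y := by nlinarith
  have hyL : y ≤ y * L := le_mul_of_one_le_right hy.le hL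
  have hnL : n * L ≤ y * L := mul_le_mul_of_nonneg_right hny (by linarith)
  have hnpL : n * p * L ≤ 2 * y * L := mul_le_mul_of_nonneg_right hnp (by linarith)
  have hr' : 2 * r ≤ n * r := mul_le_mul_of_nonneg_right hn hr
  nlinarith

theorem mainTheorem3 :
    ∃ (A : Symbolic.Prog) (C : ℝ) (k : ℕ),
      ∀ (V : Type*) [Fintype V] [Nonempty V] [MeasurableSpace V] [DiscreteMeasurableSpace V]
        (P : MDP V) (T : Set V) (ρ : Symbolic.Picker V),
        (∀ p : ℕ, ∃ s, Symbolic.Computes ρ A P T p (P.ASW (P.Reach T)) s) ∧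
        ∀ ε : ℝ, 0 < ε → ε ≤ 1 / 2 →
          ∃ s, Symbolic.Computes ρ A P T ⌈(Fintype.card V : ℝ) ^ ε⌉₊ (P.ASW (P.Reach T)) s ∧
            (s.ops : ℝ) ≤
              C * (Fintype.card V : ℝ) ^ (2 - ε) * Real.log (Fintype.card V) ^ k ∧
            s.peak ≤
              (⌊C * (Fintype.card V : ℝ) ^ ε * Real.log (Fintype.card V) ^ k⌋₊ : ℕ∞) := by
  -- The constant is `100` from `cost_bound` times `3` from `labelSize_le_log`; it is ample for the
  -- logarithmic space bound too.
  refine ⟨Symbolic.almostSureReachProg, 300, 1, fun V _ _ _ _ P T ρ => ⟨fun p => ?_,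
    fun ε hε hε' => ?_⟩⟩
  · obtain ⟨s, hs, -⟩ := Symbolic.computes_asw P T ρ p
    exact ⟨s, hs⟩
  obtain ⟨s, hs, hpeak, r, hr, hops⟩ :=
    Symbolic.computes_asw P T ρ ⌈(Fintype.card V : ℝ) ^ ε⌉₊
  have hn := P.two_le_card
  have hL := Symbolic.labelSize_le_log hn
  have hL1 : (1 : ℝ) ≤ Symbolic.labelSize V := by
    unfold Symbolic.labelSize
    push_cast
    linarith [(Nat.cast_nonneg (Nat.log 2 (Nat.card V)) : (0 : ℝ) ≤ _)]
  rw [Nat.card_eq_fintype_card] at hn hL hr hops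
  have hn' : (2 : ℝ) ≤ Fintype.card V := by exact_mod_cast hn
  have hx : 1 ≤ (Fintype.card V : ℝ) ^ ε := Real.one_le_rpow (by linarith) hε.le
  have hy : 0 ≤ (Fintype.card V : ℝ) ^ (2 - ε) := by positivity
  refine ⟨s, hs, ?_, ?_⟩
  · have hceil := Nat.ceil_lt_add_one (zero_le_one.trans hx)
    have key := cost_bound (n := Fintype.card V) (r := r) (L := Symbolic.labelSize V)
      (y := (Fintype.card V : ℝ) ^ (2 - ε)) hn' hL1 hx hceil.le (Nat.le_ceil _)
      (Nat.cast_nonneg r) (by exact_mod_cast hr) ?_ ?_ ?_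
    · have hops' : (s.ops : ℝ) ≤ _ := (Nat.cast_le (α := ℝ)).2 hops
      push_cast at hops'
      calc (s.ops : ℝ) ≤ 100 * (Fintype.card V : ℝ) ^ (2 - ε) * Symbolic.labelSize V :=
            hops'.trans key
        _ ≤ 100 * (Fintype.card V : ℝ) ^ (2 - ε) * (3 * Real.log (Fintype.card V)) :=
            mul_le_mul_of_nonneg_left hL (by positivity)
        _ = _ := by ring
    · rw [← Real.rpow_add (by linarith), ← Real.rpow_natCast]
      norm_num
    · calc (Fintype.card V : ℝ) = (Fintype.card V : ℝ) ^ (1 : ℝ) := (Real.rpow_one _).symm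
        _ ≤ _ := Real.rpow_le_rpow_of_exponent_le (by linarith) (by linarith)
    -- Here `ε ≤ 1 / 2` is used in full: reading costs about $n^{1+\epsilon}$, which must not exceed
    -- $n^{2-\epsilon}$.
    · calc (Fintype.card V : ℝ) * (Fintype.card V : ℝ) ^ ε =
            (Fintype.card V : ℝ) ^ (1 + ε) := by
              rw [Real.rpow_add (by linarith), Real.rpow_one]
        _ ≤ _ := Real.rpow_le_rpow_of_exponent_le (by linarith) (by linarith)
  · refine hpeak.trans (Nat.cast_le.2 (Nat.le_floor ?_))
    push_cast
    have hlog : 0 ≤ Real.log (Fintype.card V) := Real.log_nonneg (by linarith)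
    have := mul_le_mul_of_nonneg_right hx hlog
    rw [pow_one]
    nlinarith
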